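/- Let $\mathcal M$ be the set of Lebesgue measurable functions $f:(0,\infty)\to[-\infty,\infty]$ and $\mathcal M_+=\{f\in\mathcal M: f\ge 0\}$ (functions equal a.e. being identified). For $f\in\mathcal M$ let $f^*(t)=\inf\{\lambda\in(0,\infty): |\{x\in(0,\infty):|f(x)|>\lambda\}|\le t\}$, $t\in(0,\infty)$, be its non-increasing rearrangement. A functional $\rho:\mathcal M_+\to[0,\infty]$ is a rearrangement-invariant (r.i.) norm if for all $f,g,f_j\in\mathcal M_+$ and $\lambda\ge0$: (P1) $\rho(f)=0$ iff $f=0$ a.e., $\rho(\lambda f)=\lambda\rho(f)$, $\rho(f+g)\le\rho(f)+\rho(g)$; (P2) $f\le g$ a.e. implies $\rho(f)\le\rho(g)$; (P3) $f_j\nearrow f$ a.e. implies $\rho(f_j)\nearrow\rho(f)$; (P4) $\rho(\chi_G)<\infty$ for every measurable $G\subset(0,\infty)$ of finite measure; (P5) for every such $G$ there is a finite constant $C_G$ with $\int_G f\le C_G\,\rho(f)$ for all $f\in\mathcal M_+$; (P6) $\rho(f)=\rho(g)$ whenever $f^*=g^*$. The corresponding r.i. space is $X(\rho)=\{f\in\mathcal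 M:\rho(|f|)<\infty\}$ with norm $\|f\|_{X(\rho)}=\rho(|f|)$. The associate norm is $\rho'(g)=\sup\{\int_0^\infty fg: f\in\mathcal M_+,\ \rho(f)\le 1\}$, $g\in\mathcal M_+$, and the associate space of $X=X(\rho)$ is $X'=X(\rho')$; we use the notation $\|g\|_{X'}=\rho'(|g|)\in[0,\infty]$ for every $g\in\mathcal M$. For $a\in\mathcal M_+$ let $S_af(t)=\int_0^\infty a(st)f(s)\,ds$ whenever the integral is defined. For r.i. spaces $X$ and $Z$, $S_a:X\to Z$ means that $S_a$ is defined on all of $X$ (with $S_af(t)$ defined for a.e. $t$) and bounded from $X$ to $Z$, and $X\hookrightarrow Z$ denotes a continuous embedding. An r.i. space $Z$ is the optimal range partner for $S_a$ and $X$ if $S_a:X\to Z$ and $Z\hookrightarrow W$ for every r.i. space $W$ with $S_a:X\to W$. Theorem. Let $a\in L^1(0,\infty)\cap L^\infty(0,\infty)$ be non-trivial (not a.e. zero), non-negative and non-increasing on $(0,\infty)$, and let $Y$ be an r.i. space. (i) If the function $t\mapsto\min\{1,1/t\}$ belongs to $Y'$, then \[ \rho(f)=\Big\|\,t\mapsto\int_0^{1/t}f^*(s)\,ds\Big\|_{Y'},\qquad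 f\in\mathcal M_+, \] is an r.i. norm, and, with $\rho'$ the associate norm of $\rho$, the space $Z=X(\rho')$ is an r.i. space and is the optimal range partner for $S_a$ and $Y$; that is, $S_a:Y\to Z$, and $Z\hookrightarrow W$ for every r.i. space $W$ with $S_a:Y\to W$. (ii) If $t\mapsto\min\{1,1/t\}$ does not belong to $Y'$, then there is no r.i. space $Z$ such that $S_a:Y\to Z$. -/

import Mathlib

open MeasureTheory Set Filter Topology
open scoped ENNReal NNReal

noncomputable section

namespace RI

/-- Lebesgue measure on the half-line `(0,∞)`. Functions on `(0,∞)` are represented by functions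
on `ℝ`, whose values on `(-∞,0]` are irrelevant. -/
abbrev leb : Measure ℝ := volume.restrict (Ioi (0 : ℝ))

/-- The class `M` of Lebesgue measurable functions `(0,∞) → [-∞,∞]`. -/
def ClassM (f : ℝ → EReal) : Prop := AEMeasurable f leb

/-- The class `M₊` of Lebesgue measurable functions `(0,∞) → [0,∞]`. -/
def ClassMPos (f : ℝ → ℝ≥0∞) : Prop := AEMeasurable f leb

/-- The distribution function `f_*(l) = |{x ∈ (0,∞) : f x > l}|` of a non-negative function. -/
def distrib (f : ℝ → ℝ≥0∞) (l : ℝ≥0∞) : ℝ≥0∞ := leb {x | l < f x}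

/-- The non-increasing rearrangement `f^*(t) = inf {l ∈ (0,∞) : f_*(l) ≤ t}`, `t ∈ (0,∞)`,
of a non-negative function. -/
def rearr (f : ℝ → ℝ≥0∞) (t : ℝ) : ℝ≥0∞ :=
  sInf {l : ℝ≥0∞ | 0 < l ∧ l < ∞ ∧ distrib f l ≤ ENNReal.ofReal t}

/-- `ρ : M₊ → [0,∞]` is a Banach function norm (the values of `ρ` outside `M₊` are irrelevant). -/
structure IsBanachFunctionNorm (ρ : (ℝ → ℝ≥0∞) → ℝ≥0∞) : Prop where
  eq_zero_iff : ∀ f, ClassMPos f → (ρ f = 0 ↔ f =ᵐ[leb] 0)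
  smul : ∀ f, ClassMPos f → ∀ c : ℝ≥0, ρ (fun x => (c : ℝ≥0∞) * f x) = c * ρ f
  add_le : ∀ f g, ClassMPos f → ClassMPos g → ρ (fun x => f x + g x) ≤ ρ f + ρ g
  mono : ∀ f g, ClassMPos f → ClassMPos g → f ≤ᵐ[leb] g → ρ f ≤ ρ g
  fatou : ∀ (F : ℕ → ℝ → ℝ≥0∞) (f : ℝ → ℝ≥0∞), (∀ j, ClassMPos (F j)) → ClassMPos f →
    (∀ᵐ x ∂leb, Monotone (fun j => F j x) ∧ Tendsto (fun j => F j x) atTop (𝓝 (f x))) →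
    Monotone (fun j => ρ (F j)) ∧ Tendsto (fun j => ρ (F j)) atTop (𝓝 (ρ f))
  indicator_lt_top : ∀ G : Set ℝ, G ⊆ Ioi 0 → NullMeasurableSet G volume → volume G < ∞ →
    ρ (G.indicator 1) < ∞
  setLIntegral_le : ∀ G : Set ℝ, G ⊆ Ioi 0 → NullMeasurableSet G volume → volume G < ∞ →
    ∃ C : ℝ≥0, ∀ f, ClassMPos f → ∫⁻ x in G, f x ≤ C * ρ f

/-- `ρ` is a rearrangement-invariant norm. -/
structure IsRINorm (ρ : (ℝ → ℝ≥0∞) → ℝ≥0∞) : Prop extends IsBanachFunctionNorm ρ where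
  rearr_inv : ∀ f g, ClassMPos f → ClassMPos g → (∀ t : ℝ, 0 < t → rearr f t = rearr g t) →
    ρ f = ρ g

/-- `‖f‖_{X(ρ)} = ρ(|f|)` for `f ∈ M`. -/
def norm (ρ : (ℝ → ℝ≥0∞) → ℝ≥0∞) (f : ℝ → EReal) : ℝ≥0∞ := ρ (fun x => (f x).abs)

/-- The space `X(ρ) = {f ∈ M : ρ(|f|) < ∞}`. -/
def space (ρ : (ℝ → ℝ≥0∞) → ℝ≥0∞) : Set (ℝ → EReal) := {f | ClassM f ∧ norm ρ f < ∞}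

/-- The associate norm `ρ'(g) = sup {∫ f g : f ∈ M₊, ρ(f) ≤ 1}`. -/
def assoc (ρ : (ℝ → ℝ≥0∞) → ℝ≥0∞) (g : ℝ → ℝ≥0∞) : ℝ≥0∞ :=
  ⨆ (f : ℝ → ℝ≥0∞) (_ : ClassMPos f) (_ : ρ f ≤ 1), ∫⁻ x, f x * g x ∂leb

/-- Continuous embedding `X(ρ) ↪ X(σ)`. -/
def Embeds (ρ σ : (ℝ → ℝ≥0∞) → ℝ≥0∞) : Prop :=
  ∃ C : ℝ≥0, ∀ f ∈ space ρ, f ∈ space σ ∧ norm σ f ≤ C * norm ρ f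

/-- `∫₀^∞ a(st) f(s)⁺ ds`. -/
def SPos (a : ℝ → ℝ≥0∞) (f : ℝ → EReal) (t : ℝ) : ℝ≥0∞ :=
  ∫⁻ s, a (s * t) * (f s).toENNReal ∂leb

/-- `∫₀^∞ a(st) f(s)⁻ ds`. -/
def SNeg (a : ℝ → ℝ≥0∞) (f : ℝ → EReal) (t : ℝ) : ℝ≥0∞ :=
  ∫⁻ s, a (s * t) * (-f s).toENNReal ∂leb

/-- The Lebesgue integral defining `S_a f (t)` makes sense, that is, it is not `∞ - ∞`. -/
def SDefinedAt (a : ℝ → ℝ≥0∞) (f : ℝ → EReal) (t : ℝ) : Prop :=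
  SPos a f t ≠ ∞ ∨ SNeg a f t ≠ ∞

/-- `S_a f (t) = ∫₀^∞ a(st) f(s) ds`, meaningful where `SDefinedAt a f t` holds. -/
def S (a : ℝ → ℝ≥0∞) (f : ℝ → EReal) (t : ℝ) : EReal :=
  (SPos a f t : EReal) - (SNeg a f t : EReal)

/-- `S_a : X(ρ) → X(σ)` is (well defined and) bounded. -/
def SBounded (a : ℝ → ℝ≥0∞) (ρ σ : (ℝ → ℝ≥0∞) → ℝ≥0∞) : Prop :=
  ∃ C : ℝ≥0, ∀ f ∈ space ρ,
    (∀ᵐ t ∂leb, SDefinedAt a f t) ∧ S a f ∈ space σ ∧ norm σ (S a f) ≤ C * norm ρ f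

/-- `X(σ)` is the optimal (smallest) rearrangement-invariant range partner
for `S_a` and the domain space `X(ρ)`. -/
def IsOptimalRangePartner (a : ℝ → ℝ≥0∞) (ρ σ : (ℝ → ℝ≥0∞) → ℝ≥0∞) : Prop :=
  IsRINorm σ ∧ SBounded a ρ σ ∧ ∀ τ, IsRINorm τ → SBounded a ρ τ → Embeds σ τ

/-- `α(f)(t) = ∫₀^{1/t} f^*`, for `t ∈ (0,∞)`. -/
def alpha (f : ℝ → ℝ≥0∞) (t : ℝ) : ℝ≥0∞ := ∫⁻ s in Ioo 0 (1 / t), rearr f s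

/-- `ρ(f) = ‖α(f)‖_{X(σ)'}`, for `f ∈ M₊`. -/
def rhoAlpha (σ : (ℝ → ℝ≥0∞) → ℝ≥0∞) (f : ℝ → ℝ≥0∞) : ℝ≥0∞ := assoc σ (alpha f)

/-- The function `t ↦ min {1, 1/t}` on `(0,∞)`. -/
def minOneInv (t : ℝ) : EReal := ((min 1 (1 / t) : ℝ) : EReal)

end RI

end

namespace RI

/-! Write α(g)(t) = ∫₀^{1/t} g^*. The operator `S_a` is comparable to α: since `a` is bounded and
integrable, S_a g ≤ C α(g) for g ≥ 0 (`SNonneg_le_alpha`); since `a` is non-increasing and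
non-trivial, k α(g) ≤ S_a(g^*) with some k > 0 (`mul_alpha_le_SNonneg_rearr`). Moreover the kernel
a(st) is symmetric, so S_a is its own transpose (`lintegral_SNonneg_mul`).

Hence ∫ f S_a φ = ∫ φ S_a f ≤ C ∫ φ α(f) ≤ C Y(φ) ρ(f), that is, S_a maps Y into X(ρ'). Conversely,
if S_a maps Y into an r.i. space W, then transposing and using W'(g^*) = W'(g) gives ρ ≤ C W'
(`SBounded.rhoAlpha_le`). Dualizing, W'' ≤ C ρ', and W ≤ W'' by the Lorentz–Luxemburg theorem
(`IsBanachFunctionNorm.le_assoc_assoc`), which is optimality.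

The condition on min{1, 1/t} = α(χ_(0,1)) says that ρ(χ_(0,1)) is finite. It yields (P4) for ρ, and
it is necessary because ρ(χ_(0,1)) ≤ C W'(χ_(0,1)) < ∞ whenever a target W exists. -/

/-! ### Distribution functions and rearrangements. -/

lemma distrib_anti (f : ℝ → ℝ≥0∞) : Antitone (distrib f) := fun _ _ h =>
  measure_mono fun _ hx => lt_of_le_of_lt h hx

lemma distrib_mono {f g : ℝ → ℝ≥0∞} (h : f ≤ᵐ[leb] g) (l : ℝ≥0∞) :
    distrib f l ≤ distrib g l := by
  refine measure_mono_ae ?_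
  filter_upwards [h] with x hx hl
  exact lt_of_lt_of_le hl hx

lemma distrib_congr {f g : ℝ → ℝ≥0∞} (h : f =ᵐ[leb] g) : distrib f = distrib g :=
  funext fun l => le_antisymm (distrib_mono h.le l) (distrib_mono h.symm.le l)

/-- Right-continuity of the distribution function, by continuity of measure from below. It makes the
infimum defining `rearr` attained in `rearr_le_iff`. -/
lemma distrib_eq_iSup (f : ℝ → ℝ≥0∞) (l : ℝ≥0∞) :
    distrib f l = ⨆ n : ℕ, distrib f (l + ((n : ℝ≥0∞) + 1)⁻¹) := by
  have hmono : Monotone fun n : ℕ => {x | l + ((n : ℝ≥0∞) + 1)⁻¹ < f x} := by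
    intro m n hmn x (hx : l + ((m : ℝ≥0∞) + 1)⁻¹ < f x)
    refine lt_of_le_of_lt (b := l + ((m : ℝ≥0∞) + 1)⁻¹) ?_ hx
    gcongr
  have : {x | l < f x} = ⋃ n : ℕ, {x | l + ((n : ℝ≥0∞) + 1)⁻¹ < f x} := by
    ext x
    simp only [mem_ofPred_eq, mem_iUnion]
    constructor
    · intro hx
      obtain ⟨n, hn⟩ := ENNReal.exists_inv_nat_lt (tsub_pos_of_lt hx).ne'
      refine ⟨n, ?_⟩
      have : ((n : ℝ≥0∞) + 1)⁻¹ < f x - l :=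
        lt_of_le_of_lt (ENNReal.inv_le_inv.2 le_self_add) hn
      exact lt_tsub_iff_left.1 this
    · rintro ⟨n, hn⟩
      exact lt_of_le_of_lt le_self_add hn
  unfold distrib
  rw [this, hmono.measure_iUnion]

lemma rearr_le_iff (f : ℝ → ℝ≥0∞) (t : ℝ) {l : ℝ≥0∞} (hl : l < ∞) :
    rearr f t ≤ l ↔ distrib f l ≤ ENNReal.ofReal t := by
  constructor
  · intro h
    rw [distrib_eq_iSup f l]
    refine iSup_le fun n => ?_
    have h1 : rearr f t < l + ((n : ℝ≥0∞) + 1)⁻¹ :=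
      lt_of_le_of_lt h (ENNReal.lt_add_right hl.ne (by simp))
    obtain ⟨m, hm, hm'⟩ := sInf_lt_iff.1 h1
    exact (distrib_anti f hm'.le).trans hm.2.2
  · intro h
    refine le_of_forall_gt_imp_ge_of_dense fun m hm => ?_
    obtain ⟨k, hk, hk'⟩ := exists_between hm
    refine le_trans (sInf_le ⟨(zero_le (a := l)).trans_lt hk, hk'.trans_le le_top, ?_⟩) hk'.le
    exact (distrib_anti f hk.le).trans h

lemma lt_rearr_iff (f : ℝ → ℝ≥0∞) (t : ℝ) {l : ℝ≥0∞} (hl : l < ∞) :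
    l < rearr f t ↔ ENNReal.ofReal t < distrib f l := by
  rw [← not_le, rearr_le_iff f t hl, not_le]

lemma rearr_anti (f : ℝ → ℝ≥0∞) : Antitone (rearr f) := fun _ _ h =>
  sInf_le_sInf fun _ hl => ⟨hl.1, hl.2.1, hl.2.2.trans (ENNReal.ofReal_le_ofReal h)⟩

lemma rearr_measurable (f : ℝ → ℝ≥0∞) : Measurable (rearr f) := (rearr_anti f).measurable

lemma distrib_top (f : ℝ → ℝ≥0∞) : distrib f ∞ = 0 := by simp [distrib]

lemma leb_ofReal_lt (D : ℝ≥0∞) : leb {t : ℝ | ENNReal.ofReal t < D} = D := by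
  rw [Measure.restrict_apply (measurableSet_lt ENNReal.measurable_ofReal measurable_const)]
  rcases eq_or_ne D ∞ with rfl | hD
  · have : {t : ℝ | ENNReal.ofReal t < ∞} ∩ Ioi 0 = Ioi 0 := by
      ext t; simp
    rw [this, Real.volume_Ioi]
  · have : {t : ℝ | ENNReal.ofReal t < D} ∩ Ioi 0 = Ioo 0 D.toReal := by
      ext t
      simp only [mem_inter_iff, mem_ofPred_eq, mem_Ioi, mem_Ioo]
      constructor
      · rintro ⟨h1, h2⟩
        exact ⟨h2, (ENNReal.ofReal_lt_iff_lt_toReal h2.le hD).1 h1⟩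
      · rintro ⟨h1, h2⟩
        exact ⟨(ENNReal.ofReal_lt_iff_lt_toReal h1.le hD).2 h2, h1⟩
    rw [this, Real.volume_Ioo, sub_zero, ENNReal.ofReal_toReal hD]

lemma distrib_rearr (f : ℝ → ℝ≥0∞) : distrib (rearr f) = distrib f := by
  funext l
  rcases eq_or_ne l ∞ with rfl | hl
  · simp [distrib_top]
  · have : {t | l < rearr f t} = {t : ℝ | ENNReal.ofReal t < distrib f l} := by
      ext t; exact lt_rearr_iff f t hl.lt_top
    conv_lhs => unfold distrib
    rw [this, leb_ofReal_lt]

lemma distrib_eq_of_rearr_eq {f g : ℝ → ℝ≥0∞} (h : ∀ t : ℝ, 0 < t → rearr f t = rearr g t) :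
    distrib f = distrib g := by
  rw [← distrib_rearr f, ← distrib_rearr g]
  refine distrib_congr ?_
  filter_upwards [ae_restrict_mem measurableSet_Ioi] with t ht using h t ht

lemma rearr_congr {f g : ℝ → ℝ≥0∞} (h : distrib f = distrib g) : rearr f = rearr g := by
  funext t; simp only [rearr, h]

/-! ### Integrals of rearrangements and the K-functional of (L¹, L^∞). -/

/-- Layer cake formula. -/
lemma lintegral_eq_lintegral_distrib {f : ℝ → ℝ≥0∞} (hf : ClassMPos f) :
    ∫⁻ x, f x ∂leb = ∫⁻ s, distrib f (ENNReal.ofReal s) ∂leb := by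
  have key : ∀ g : ℝ → ℝ≥0∞, Measurable g →
      ∫⁻ x, g x ∂leb = ∫⁻ s, distrib g (ENNReal.ofReal s) ∂leb := by
    intro g hg
    have hm : MeasurableSet {p : ℝ × ℝ | ENNReal.ofReal p.2 < g p.1} :=
      measurableSet_lt (ENNReal.measurable_ofReal.comp measurable_snd) (hg.comp measurable_fst)
    -- The measure of the subgraph of `g`, sliced in either order.
    have h1 := Measure.prod_apply (μ := leb) (ν := leb) hm
    rw [Measure.prod_apply_symm hm] at h1
    simp only [preimage_ofPred_eq, leb_ofReal_lt] at h1
    exact h1.symm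
  rw [lintegral_congr_ae hf.ae_eq_mk, distrib_congr hf.ae_eq_mk]
  exact key _ hf.measurable_mk

lemma lintegral_eq_of_distrib_eq {f g : ℝ → ℝ≥0∞} (hf : ClassMPos f) (hg : ClassMPos g)
    (h : distrib f = distrib g) : ∫⁻ x, f x ∂leb = ∫⁻ x, g x ∂leb := by
  rw [lintegral_eq_lintegral_distrib hf, lintegral_eq_lintegral_distrib hg, h]

lemma distrib_tsub (f : ℝ → ℝ≥0∞) (l m : ℝ≥0∞) :
    distrib (fun x => f x - l) m = distrib f (l + m) := by
  simp only [distrib, lt_tsub_iff_left]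

lemma lintegral_rearr_tsub {f : ℝ → ℝ≥0∞} (hf : ClassMPos f) (l : ℝ≥0∞) :
    ∫⁻ x, (rearr f x - l) ∂leb = ∫⁻ x, (f x - l) ∂leb := by
  refine lintegral_eq_of_distrib_eq ((rearr_measurable f).sub_const l).aemeasurable
    (hf.sub_const l) ?_
  funext m
  rw [distrib_tsub, distrib_tsub, distrib_rearr]

lemma setLIntegral_le_add (f : ℝ → ℝ≥0∞) (l : ℝ≥0∞) {G : Set ℝ} (hG : G ⊆ Ioi 0) :
    ∫⁻ x in G, f x ≤ l * volume G + ∫⁻ x, (f x - l) ∂leb :=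
  calc ∫⁻ x in G, f x ≤ ∫⁻ x in G, (l + (f x - l)) := lintegral_mono fun x => le_add_tsub
    _ = l * volume G + ∫⁻ x in G, (f x - l) := by
        rw [lintegral_add_left measurable_const, setLIntegral_const]
    _ ≤ _ := by
        exact add_le_add le_rfl (lintegral_mono_set hG)

/-- Primitive of the rearrangement as a `K`-functional. -/
lemma setLIntegral_rearr {f : ℝ → ℝ≥0∞} (hf : ClassMPos f) {r : ℝ} (hr : 0 < r) :
    ∫⁻ s in Ioo 0 r, rearr f s =
      ⨅ l : ℝ≥0, (l * ENNReal.ofReal r + ∫⁻ x, (f x - l) ∂leb) := by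
  refine le_antisymm (le_iInf fun l => ?_) ?_
  · rw [← lintegral_rearr_tsub hf]
    refine (setLIntegral_le_add _ (l : ℝ≥0∞) Ioo_subset_Ioi_self).trans ?_
    rw [Real.volume_Ioo, sub_zero]
  · rcases eq_or_ne (rearr f r) ∞ with h | h
    · have : ∫⁻ s in Ioo 0 r, rearr f s = ∞ := by
        refine top_le_iff.1 ?_
        calc ∞ = ∞ * volume (Ioo 0 r) := by
              rw [ENNReal.top_mul]; simpa using hr
          _ = ∫⁻ s in Ioo 0 r, ∞ := (setLIntegral_const _ _).symm
          _ ≤ _ := setLIntegral_mono (rearr_measurable f) fun s hs => h ▸ rearr_anti f hs.2.le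
      rw [this]; exact le_top
    · obtain ⟨l, hl⟩ : ∃ l : ℝ≥0, (l : ℝ≥0∞) = rearr f r := ⟨_, ENNReal.coe_toNNReal h⟩
      refine (iInf_le _ l).trans ?_
      rw [← lintegral_rearr_tsub hf, hl]
      have h1 : ∫⁻ x, (rearr f x - rearr f r) ∂leb
          = ∫⁻ x in Ioo 0 r, (rearr f x - rearr f r) := by
        have : Ioi (0 : ℝ) = Ioo 0 r ∪ Ici r := by rw [Ioo_union_Ici_eq_Ioi hr]
        unfold leb
        rw [this, lintegral_union measurableSet_Ici (by
          rw [Set.disjoint_left]; intro x hx hx'; exact absurd hx.2 (not_lt.2 hx'))]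
        rw [setLIntegral_congr_fun measurableSet_Ici (g := fun _ => 0)
          fun x hx => tsub_eq_zero_of_le (rearr_anti f hx)]
        simp
      have h2 : rearr f r * ENNReal.ofReal r = ∫⁻ x in Ioo 0 r, rearr f r := by
        rw [setLIntegral_const, Real.volume_Ioo, sub_zero]
      rw [h1, h2, ← lintegral_add_left measurable_const]
      exact (setLIntegral_congr_fun measurableSet_Ioo fun x hx =>
        add_tsub_cancel_of_le (rearr_anti f hx.2.le)).le

/-! ### The operator α. -/

lemma alpha_eq {f : ℝ → ℝ≥0∞} (hf : ClassMPos f) {t : ℝ} (ht : 0 < t) :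
    alpha f t = ⨅ l : ℝ≥0, (l * ENNReal.ofReal (1 / t) + ∫⁻ x, (f x - l) ∂leb) :=
  setLIntegral_rearr hf (one_div_pos.2 ht)

lemma alpha_antitoneOn (f : ℝ → ℝ≥0∞) : AntitoneOn (alpha f) (Ioi 0) := fun _ hs _ _ h =>
  lintegral_mono_set (Ioo_subset_Ioo_right (one_div_le_one_div_of_le hs h))

lemma classMPos_alpha (f : ℝ → ℝ≥0∞) : ClassMPos (alpha f) :=
  aemeasurable_restrict_of_antitoneOn measurableSet_Ioi (alpha_antitoneOn f)

/-- Although f ↦ f^* is not subadditive, its primitive is: levels l for f and m for g combine to the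
level l + m for f + g in the K-functional. -/
lemma alpha_add_le {f g : ℝ → ℝ≥0∞} (hf : ClassMPos f) (hg : ClassMPos g) {t : ℝ} (ht : 0 < t) :
    alpha (fun x => f x + g x) t ≤ alpha f t + alpha g t := by
  rw [alpha_eq hf ht, alpha_eq hg ht, alpha_eq (f := fun x => f x + g x) (hf.add hg) ht]
  refine ENNReal.le_iInf_add_iInf fun l m => (iInf_le _ (l + m)).trans ?_
  calc _ ≤ ((l : ℝ≥0∞) + m) * ENNReal.ofReal (1 / t) +
        ∫⁻ x, ((f x - l) + (g x - m)) ∂leb := by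
        push_cast
        gcongr with x
        rw [tsub_le_iff_right]
        calc f x + g x ≤ (f x - l + l) + (g x - m + m) := by gcongr <;> exact le_tsub_add
          _ = _ := by ring
    _ = _ := by
        rw [lintegral_add_left' (hf.sub_const _)]
        ring

lemma rearr_mono {f g : ℝ → ℝ≥0∞} (h : f ≤ᵐ[leb] g) (t : ℝ) : rearr f t ≤ rearr g t :=
  sInf_le_sInf fun _ hl => ⟨hl.1, hl.2.1, (distrib_mono h _).trans hl.2.2⟩

lemma alpha_mono {f g : ℝ → ℝ≥0∞} (h : f ≤ᵐ[leb] g) (t : ℝ) : alpha f t ≤ alpha g t :=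
  lintegral_mono fun s => rearr_mono h s

lemma le_of_forall_nnreal_le {x y : ℝ≥0∞} (h : ∀ l : ℝ≥0, y ≤ l → x ≤ l) : x ≤ y := by
  rcases eq_or_ne y ∞ with rfl | hy
  · exact le_top
  · lift y to ℝ≥0 using hy
    exact h y le_rfl

lemma rearr_const_mul (f : ℝ → ℝ≥0∞) (c : ℝ≥0) (t : ℝ) :
    rearr (fun x => c * f x) t = c * rearr f t := by
  rcases eq_or_ne c 0 with rfl | hc
  · have : rearr (fun x => ((0 : ℝ≥0) : ℝ≥0∞) * f x) t ≤ 0 := by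
      rw [rearr_le_iff _ _ (by simp)]; simp [distrib]
    simpa using this
  · have hc' : (c : ℝ≥0∞) ≠ 0 := by simpa using hc
    have h : ∀ l : ℝ≥0, rearr (fun x => c * f x) t ≤ l ↔ c * rearr f t ≤ l := by
      intro l
      rw [rearr_le_iff _ _ (by simp), mul_comm (c : ℝ≥0∞),
        ← ENNReal.le_div_iff_mul_le (Or.inl hc') (Or.inl (by simp)),
        rearr_le_iff _ _ (ENNReal.div_lt_top (by simp) hc')]
      have : distrib (fun x => c * f x) l = distrib f (l / c) := by
        unfold distrib
        congr 1; ext x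
        simp only [mem_ofPred_eq]
        rw [ENNReal.div_lt_iff (Or.inl hc') (Or.inl (by simp)), mul_comm]
      rw [this]
    exact le_antisymm (le_of_forall_nnreal_le fun l hl => (h l).2 hl)
      (le_of_forall_nnreal_le fun l hl => (h l).1 hl)

lemma alpha_const_mul (f : ℝ → ℝ≥0∞) (c : ℝ≥0) (t : ℝ) :
    alpha (fun x => c * f x) t = c * alpha f t := by
  unfold alpha
  simp only [rearr_const_mul]
  rw [lintegral_const_mul _ (rearr_measurable f)]

lemma rearr_eq_iSup {F : ℕ → ℝ → ℝ≥0∞} {f : ℝ → ℝ≥0∞}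
    (h : ∀ᵐ x ∂leb, Monotone (fun j => F j x) ∧ Tendsto (fun j => F j x) atTop (𝓝 (f x)))
    (t : ℝ) : rearr f t = ⨆ j, rearr (F j) t := by
  have hle : ∀ j, F j ≤ᵐ[leb] f := fun j => by
    filter_upwards [h] with x hx using hx.1.ge_of_tendsto hx.2 j
  refine le_antisymm (le_of_forall_nnreal_le fun l hl => ?_)
    (iSup_le fun j => rearr_mono (hle j) t)
  rw [rearr_le_iff _ _ (by simp)]
  have hl' : ∀ j, distrib (F j) l ≤ ENNReal.ofReal t := fun j =>
    (rearr_le_iff _ _ (by simp)).1 ((le_iSup (fun j => rearr (F j) t) j).trans hl)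
  -- The level sets of `F j` increase only up to null sets; collecting all indices j ≤ n makes them
  -- increase everywhere.
  let s : ℕ → Set ℝ := fun n => {x | ∃ j ≤ n, (l : ℝ≥0∞) < F j x}
  have hs : Monotone s := fun m n hmn x ⟨j, hj, hx⟩ => ⟨j, hj.trans hmn, hx⟩
  calc distrib f l ≤ leb (⋃ n, s n) := by
        refine measure_mono_ae ?_
        filter_upwards [h] with x hx hlx
        obtain ⟨j, hj⟩ := (hx.2.eventually (lt_mem_nhds hlx)).exists
        exact mem_iUnion.2 ⟨j, j, le_rfl, hj⟩
    _ = ⨆ n, leb (s n) := hs.measure_iUnion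
    _ ≤ ENNReal.ofReal t := by
        refine iSup_le fun n => le_trans (measure_mono_ae ?_) (hl' n)
        filter_upwards [h] with x hx hsx
        obtain ⟨j, hj, hjx⟩ := hsx
        exact lt_of_lt_of_le hjx (hx.1 hj)

lemma rearr_seq_mono {F : ℕ → ℝ → ℝ≥0∞} (h : ∀ᵐ x ∂leb, Monotone (fun j => F j x)) (t : ℝ) :
    Monotone fun j => rearr (F j) t := fun i j hij =>
  rearr_mono (by filter_upwards [h] with x hx using hx hij) t

lemma alpha_eq_iSup {F : ℕ → ℝ → ℝ≥0∞} {f : ℝ → ℝ≥0∞}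
    (h : ∀ᵐ x ∂leb, Monotone (fun j => F j x) ∧ Tendsto (fun j => F j x) atTop (𝓝 (f x)))
    (t : ℝ) : alpha f t = ⨆ j, alpha (F j) t := by
  unfold alpha
  simp only [rearr_eq_iSup h]
  exact lintegral_iSup (fun j => rearr_measurable _) fun i j hij s =>
    rearr_seq_mono (h.mono fun x hx => hx.1) s hij

lemma setLIntegral_le_alpha {f : ℝ → ℝ≥0∞} (hf : ClassMPos f) {G : Set ℝ} (hG : G ⊆ Ioi 0)
    {t : ℝ} (ht : 0 < t) (hGt : volume G ≤ ENNReal.ofReal (1 / t)) :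
    ∫⁻ x in G, f x ≤ alpha f t := by
  rw [alpha_eq hf ht]
  refine le_iInf fun l => (setLIntegral_le_add f l hG).trans ?_
  gcongr

/-! ### Associate norms. -/

variable {ρ : (ℝ → ℝ≥0∞) → ℝ≥0∞}

lemma ClassMPos.fun_mul {f g : ℝ → ℝ≥0∞} (hf : ClassMPos f) (hg : ClassMPos g) :
    ClassMPos fun x => f x * g x := AEMeasurable.mul hf hg

lemma le_assoc {f g : ℝ → ℝ≥0∞} (hf : ClassMPos f) (h : ρ f ≤ 1) :
    ∫⁻ x, f x * g x ∂leb ≤ assoc ρ g :=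
  le_iSup_of_le f (le_iSup_of_le hf (le_iSup_of_le h le_rfl))

lemma assoc_le {g : ℝ → ℝ≥0∞} {C : ℝ≥0∞}
    (h : ∀ f, ClassMPos f → ρ f ≤ 1 → ∫⁻ x, f x * g x ∂leb ≤ C) : assoc ρ g ≤ C :=
  iSup_le fun f => iSup_le fun hf => iSup_le fun hf' => h f hf hf'

lemma assoc_mono {g h : ℝ → ℝ≥0∞} (hgh : g ≤ᵐ[leb] h) : assoc ρ g ≤ assoc ρ h :=
  assoc_le fun f hf hf' => le_trans (lintegral_mono_ae (by
    filter_upwards [hgh] with x hx; gcongr)) (le_assoc hf hf')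

lemma assoc_congr {g h : ℝ → ℝ≥0∞} (hgh : g =ᵐ[leb] h) : assoc ρ g = assoc ρ h :=
  le_antisymm (assoc_mono hgh.le) (assoc_mono hgh.symm.le)

lemma assoc_add_le {g h : ℝ → ℝ≥0∞} (hg : ClassMPos g) :
    assoc ρ (fun x => g x + h x) ≤ assoc ρ g + assoc ρ h := by
  refine assoc_le fun f hf hf' => ?_
  simp only [mul_add]
  rw [lintegral_add_left' (hf.fun_mul hg)]
  exact add_le_add (le_assoc hf hf') (le_assoc hf hf')

lemma assoc_const_mul (c : ℝ≥0∞) {g : ℝ → ℝ≥0∞} (hg : ClassMPos g) :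
    assoc ρ (fun x => c * g x) = c * assoc ρ g := by
  unfold assoc
  simp only [ENNReal.mul_iSup]
  refine iSup_congr fun f => iSup_congr fun hf => iSup_congr fun _ => ?_
  rw [← lintegral_const_mul'' _ (hf.fun_mul hg)]
  simp only [mul_left_comm]

lemma assoc_eq_iSup {F : ℕ → ℝ → ℝ≥0∞} {g : ℝ → ℝ≥0∞} (hF : ∀ j, ClassMPos (F j))
    (h : ∀ᵐ x ∂leb, Monotone (fun j => F j x) ∧ Tendsto (fun j => F j x) atTop (𝓝 (g x))) :
    assoc ρ g = ⨆ j, assoc ρ (F j) := by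
  refine le_antisymm (assoc_le fun f hf hf' => ?_) (iSup_le fun j => assoc_mono ?_)
  · have : ∫⁻ x, f x * g x ∂leb = ∫⁻ x, ⨆ j, f x * F j x ∂leb := by
      refine lintegral_congr_ae ?_
      filter_upwards [h] with x hx
      rw [← ENNReal.mul_iSup, iSup_eq_of_tendsto hx.1 hx.2]
    rw [this, lintegral_iSup' (fun j => hf.fun_mul (hF j))]
    · exact iSup_mono fun j => le_assoc hf hf'
    · filter_upwards [h] with x hx i j hij
      exact mul_le_mul_right (hx.1 hij) _
  · filter_upwards [h] with x hx using hx.1.ge_of_tendsto hx.2 j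

lemma classMPos_indicator_one {G : Set ℝ} (hm : NullMeasurableSet G volume) :
    ClassMPos (G.indicator 1) :=
  aemeasurable_one.indicator₀ (hm.mono_ac Measure.restrict_le_self.absolutelyContinuous)

lemma leb_restrict {G : Set ℝ} (hG : G ⊆ Ioi 0) : leb.restrict G = volume.restrict G :=
  Measure.restrict_restrict_of_subset hG

lemma lintegral_mul_indicator_one (f : ℝ → ℝ≥0∞) {G : Set ℝ} (hG : G ⊆ Ioi 0)
    (hm : NullMeasurableSet G volume) :
    ∫⁻ x, f x * G.indicator 1 x ∂leb = ∫⁻ x in G, f x := by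
  rw [← leb_restrict hG, ← lintegral_indicator₀
    (hm.mono_ac Measure.restrict_le_self.absolutelyContinuous)]
  congr 1; ext x
  by_cases hx : x ∈ G <;> simp [hx]

lemma ae_eq_zero_of_setLIntegral_Ioo {g : ℝ → ℝ≥0∞} (hg : ClassMPos g)
    (h : ∀ n : ℕ, ∫⁻ x in Ioo (0 : ℝ) n, g x = 0) : g =ᵐ[leb] 0 := by
  have hU : Ioi (0 : ℝ) = ⋃ n : ℕ, Ioo (0 : ℝ) n := by
    ext x
    simp only [mem_Ioi, mem_iUnion, mem_Ioo, exists_and_left]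
    exact ⟨fun hx => ⟨hx, exists_nat_gt x⟩, fun hx => hx.1⟩
  rw [EventuallyEq, leb, hU, ae_restrict_iUnion_iff]
  intro n
  exact (lintegral_eq_zero_iff' (hg.mono_measure
    (Measure.restrict_mono Ioo_subset_Ioi_self le_rfl))).1 (h n)

/-- Hölder's inequality, by normalizing f; when ρ(f) = 0 no normalization is possible, but then f =
0 a.e. -/
lemma IsBanachFunctionNorm.lintegral_mul_le (hρ : IsBanachFunctionNorm ρ) {f g : ℝ → ℝ≥0∞}
    (hf : ClassMPos f) (hfin : ρ f < ∞) :
    ∫⁻ x, f x * g x ∂leb ≤ ρ f * assoc ρ g := by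
  rcases eq_or_ne (ρ f) 0 with h0 | h0
  · have := (hρ.eq_zero_iff f hf).1 h0
    rw [lintegral_congr_ae (g := fun _ => 0) (by filter_upwards [this] with x hx; simp [hx])]
    simp
  · obtain ⟨c, hc⟩ : ∃ c : ℝ≥0, (c : ℝ≥0∞) = (ρ f)⁻¹ :=
      ⟨_, ENNReal.coe_toNNReal (ENNReal.inv_ne_top.2 h0)⟩
    have h1 : ∫⁻ x, ((c : ℝ≥0∞) * f x) * g x ∂leb ≤ assoc ρ g := by
      refine le_assoc (hf.const_mul _) ?_
      rw [hρ.smul f hf, hc, ENNReal.inv_mul_cancel h0 hfin.ne]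
    simp only [mul_assoc] at h1
    rw [lintegral_const_mul' _ _ (by simp), hc] at h1
    rwa [ENNReal.inv_mul_le_iff h0 hfin.ne] at h1

/-- Associate norms are Banach function norms. -/
lemma IsBanachFunctionNorm.assoc (hρ : IsBanachFunctionNorm ρ) :
    IsBanachFunctionNorm (assoc ρ) := by
  -- Under duality (P4) and (P5) exchange roles: (P4) for ρ gives (P5) for ρ' through this
  -- inequality, and (P5) for ρ gives (P4) for ρ'.
  have hset : ∀ G : Set ℝ, G ⊆ Ioi 0 → NullMeasurableSet G volume → volume G < ∞ →
      ∀ f, ∫⁻ x in G, f x ≤ ρ (G.indicator 1) * RI.assoc ρ f := by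
    intro G hG hm hfin f
    rw [← lintegral_mul_indicator_one f hG hm]
    simp only [mul_comm (f _)]
    exact hρ.lintegral_mul_le (classMPos_indicator_one hm) (hρ.indicator_lt_top G hG hm hfin)
  refine ⟨fun f hf => ⟨fun h => ?_, fun h => ?_⟩, fun f hf c => assoc_const_mul c hf,
    fun f g hf hg => assoc_add_le hf, fun f g _ _ h => assoc_mono h,
    fun F f hF hf h => ?_, fun G hG hm hfin => ?_, fun G hG hm hfin => ?_⟩
  · refine ae_eq_zero_of_setLIntegral_Ioo hf fun n => ?_
    have := hset (Ioo 0 n) Ioo_subset_Ioi_self measurableSet_Ioo.nullMeasurableSet (by simp) f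
    simpa [h] using this
  · rw [assoc_congr h]
    exact le_antisymm (assoc_le fun f _ _ => by simp) zero_le
  · have hm : Monotone fun j => RI.assoc ρ (F j) := fun i j hij => assoc_mono (by
      filter_upwards [h] with x hx using hx.1 hij)
    refine ⟨hm, ?_⟩
    rw [assoc_eq_iSup hF h]
    exact tendsto_atTop_iSup hm
  · obtain ⟨C, hC⟩ := hρ.setLIntegral_le G hG hm hfin
    refine lt_of_le_of_lt (assoc_le (C := C) fun f hf hf' => ?_) ENNReal.coe_lt_top
    rw [lintegral_mul_indicator_one f hG hm]
    refine (hC f hf).trans ?_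
    calc (C : ℝ≥0∞) * ρ f ≤ C * 1 := by gcongr
      _ = C := mul_one _
  · refine ⟨(ρ (G.indicator 1)).toNNReal, fun f _ => ?_⟩
    rw [ENNReal.coe_toNNReal (hρ.indicator_lt_top G hG hm hfin).ne]
    exact hset G hG hm hfin f

/-- A bound on `ρ` by a multiple of `σ` dualizes. -/
lemma assoc_le_of_le {σ : (ℝ → ℝ≥0∞) → ℝ≥0∞} (hρ : IsBanachFunctionNorm ρ) {C : ℝ≥0}
    (h : ∀ f, ClassMPos f → ρ f ≤ C * σ f) (g : ℝ → ℝ≥0∞) :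
    assoc σ g ≤ C * assoc ρ g := by
  refine assoc_le fun f hf hf' => ?_
  have h1 : ρ f ≤ C := (h f hf).trans (by
    calc (C : ℝ≥0∞) * σ f ≤ C * 1 := by gcongr
      _ = C := mul_one _)
  refine (hρ.lintegral_mul_le hf (h1.trans_lt ENNReal.coe_lt_top)).trans ?_
  gcongr

/-! ### The Lorentz–Luxemburg theorem. -/

/-- Truncation in both height and support. -/
noncomputable def trunc (f : ℝ → ℝ≥0∞) (n : ℕ) : ℝ → ℝ≥0∞ :=
  (Ioo (0 : ℝ) n).indicator fun x => min (f x) n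

lemma ClassMPos.trunc {f : ℝ → ℝ≥0∞} (hf : ClassMPos f) (n : ℕ) : ClassMPos (trunc f n) :=
  (AEMeasurable.min hf aemeasurable_const).indicator measurableSet_Ioo

lemma trunc_mono (f : ℝ → ℝ≥0∞) (x : ℝ) : Monotone fun n => trunc f n x := by
  intro m n hmn
  have hmn' : (m : ℝ≥0∞) ≤ n := by exact_mod_cast hmn
  have hmn'' : (m : ℝ) ≤ n := by exact_mod_cast hmn
  by_cases hx : x ∈ Ioo (0 : ℝ) m
  · have hx' : x ∈ Ioo (0 : ℝ) n := ⟨hx.1, hx.2.trans_le hmn''⟩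
    simp only [trunc, indicator_of_mem hx, indicator_of_mem hx']
    exact min_le_min le_rfl hmn'
  · simp [trunc, indicator_of_notMem hx]

lemma trunc_le (f : ℝ → ℝ≥0∞) (n : ℕ) (x : ℝ) : trunc f n x ≤ f x :=
  indicator_apply_le fun _ => min_le_left _ _

lemma tendsto_trunc (f : ℝ → ℝ≥0∞) {x : ℝ} (hx : 0 < x) :
    Tendsto (fun n => trunc f n x) atTop (𝓝 (f x)) := by
  have h1 : Tendsto (fun n : ℕ => min (f x) (n : ℝ≥0∞)) atTop (𝓝 (f x)) := by
    have := (tendsto_const_nhds (x := f x)).min ENNReal.tendsto_nat_nhds_top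
    simpa using this
  refine h1.congr' ?_
  obtain ⟨N, hN⟩ := exists_nat_gt x
  filter_upwards [eventually_ge_atTop N] with n hn
  have : x ∈ Ioo (0 : ℝ) n := ⟨hx, hN.trans_le (by exact_mod_cast hn)⟩
  simp [trunc, this]

lemma ae_trunc (f : ℝ → ℝ≥0∞) : ∀ᵐ x ∂leb,
    Monotone (fun n => trunc f n x) ∧ Tendsto (fun n => trunc f n x) atTop (𝓝 (f x)) := by
  filter_upwards [ae_restrict_mem measurableSet_Ioi] with x hx
  exact ⟨trunc_mono f x, tendsto_trunc f hx⟩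

/-- The positive part of `u` on `(0,n)`, extended by zero. -/
noncomputable def posOn (n : ℕ) (u : ℝ → ℝ) : ℝ → ℝ≥0∞ :=
  (Ioo (0 : ℝ) n).indicator fun x => ENNReal.ofReal (u x)

lemma ae_leb_of_ae_Ioo {n : ℕ} {p : ℝ → Prop}
    (h : ∀ᵐ x ∂(volume.restrict (Ioo (0 : ℝ) n)), p x) :
    ∀ᵐ x ∂leb, x ∈ Ioo (0 : ℝ) n → p x := by
  rw [← leb_restrict Ioo_subset_Ioi_self] at h
  exact (ae_restrict_iff' measurableSet_Ioo).1 h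

lemma classMPos_posOn {n : ℕ} {u : ℝ → ℝ}
    (hu : AEMeasurable u (volume.restrict (Ioo (0 : ℝ) n))) : ClassMPos (posOn n u) := by
  refine (aemeasurable_indicator_iff measurableSet_Ioo).2 ?_
  rw [leb_restrict Ioo_subset_Ioi_self]
  exact hu.ennreal_ofReal

lemma posOn_congr {n : ℕ} {u v : ℝ → ℝ} (h : u =ᵐ[volume.restrict (Ioo (0 : ℝ) n)] v) :
    posOn n u =ᵐ[leb] posOn n v := by
  filter_upwards [ae_leb_of_ae_Ioo h] with x hx
  by_cases hxI : x ∈ Ioo (0 : ℝ) n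
  · simp [posOn, hxI, hx hxI]
  · simp [posOn, hxI]

variable {τ : (ℝ → ℝ≥0∞) → ℝ≥0∞}

lemma IsBanachFunctionNorm.congr (hτ : IsBanachFunctionNorm τ) {f g : ℝ → ℝ≥0∞}
    (hf : ClassMPos f) (hg : ClassMPos g) (h : f =ᵐ[leb] g) : τ f = τ g :=
  le_antisymm (hτ.mono f g hf hg h.le) (hτ.mono g f hg hf h.symm.le)

/-- The trace on `L²(0,n)` of the unit ball of `τ`. -/
def ballLp (τ : (ℝ → ℝ≥0∞) → ℝ≥0∞) (n : ℕ) :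
    Set (Lp ℝ 2 (volume.restrict (Ioo (0 : ℝ) n))) := {u | τ (posOn n u) ≤ 1}

lemma classMPos_posOn_Lp {n : ℕ} (u : Lp ℝ 2 (volume.restrict (Ioo (0 : ℝ) n))) :
    ClassMPos (posOn n u) := classMPos_posOn (Lp.aestronglyMeasurable u).aemeasurable

/-- Taking positive parts is sublinear, so convexity follows from the triangle inequality,
homogeneity and monotonicity of τ. -/
lemma convex_ballLp (hτ : IsBanachFunctionNorm τ) (n : ℕ) : Convex ℝ (ballLp τ n) := by
  intro u hu v hv a b ha hb hab
  have hU := classMPos_posOn_Lp u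
  have hV := classMPos_posOn_Lp v
  lift a to ℝ≥0 using ha
  lift b to ℝ≥0 using hb
  have hle : posOn n ((a : ℝ) • u + (b : ℝ) • v : Lp ℝ 2 _) ≤ᵐ[leb]
      fun x => (a : ℝ≥0∞) * posOn n u x + (b : ℝ≥0∞) * posOn n v x := by
    filter_upwards [ae_leb_of_ae_Ioo (Lp.coeFn_add ((a : ℝ) • u) ((b : ℝ) • v)),
      ae_leb_of_ae_Ioo (Lp.coeFn_smul (a : ℝ) u), ae_leb_of_ae_Ioo (Lp.coeFn_smul (b : ℝ) v)]
      with x h1 h2 h3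
    by_cases hx : x ∈ Ioo (0 : ℝ) n
    · simp only [posOn, indicator_of_mem hx, h1 hx, Pi.add_apply, h2 hx, h3 hx, Pi.smul_apply,
        smul_eq_mul]
      refine ENNReal.ofReal_add_le.trans ?_
      rw [ENNReal.ofReal_mul a.coe_nonneg, ENNReal.ofReal_mul b.coe_nonneg]
      simp
    · simp [posOn, hx]
  change τ _ ≤ 1
  calc _ ≤ τ (fun x => (a : ℝ≥0∞) * posOn n u x + (b : ℝ≥0∞) * posOn n v x) :=
        hτ.mono _ _ (classMPos_posOn_Lp _) ((hU.const_mul _).add (hV.const_mul _)) hle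
    _ ≤ _ := hτ.add_le _ _ (hU.const_mul _) (hV.const_mul _)
    _ = a * τ (posOn n u) + b * τ (posOn n v) := by rw [hτ.smul _ hU, hτ.smul _ hV]
    _ ≤ a * 1 + b * 1 := by
        gcongr
        · exact hu
        · exact hv
    _ = 1 := by
        rw [mul_one, mul_one]
        exact_mod_cast hab

/-- This is the Fatou property: along an a.e. convergent subsequence, the tail infima increase to
the limit and stay below members of the ball. -/
lemma isClosed_ballLp (hτ : IsBanachFunctionNorm τ) (n : ℕ) : IsClosed (ballLp τ n) := by
  refine IsSeqClosed.isClosed fun u v hu huv => ?_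
  obtain ⟨ns, -, hns⟩ := (tendstoInMeasure_of_tendsto_Lp huv).exists_seq_tendsto_ae
  let G : ℕ → ℝ → ℝ≥0∞ := fun j x => ⨅ k ≥ j, posOn n (u (ns k)) x
  have hG : ∀ j, ClassMPos (G j) := fun j =>
    AEMeasurable.biInf _ (to_countable _) fun k _ => classMPos_posOn_Lp _
  have hmono : ∀ x, Monotone fun j => G j x := fun x i j hij =>
    le_iInf₂ fun k hk => iInf₂_le k (le_trans hij hk)
  have hlim : ∀ᵐ x ∂leb, Monotone (fun j => G j x) ∧
      Tendsto (fun j => G j x) atTop (𝓝 (posOn n v x)) := by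
    filter_upwards [ae_leb_of_ae_Ioo hns] with x hx
    refine ⟨hmono x, ?_⟩
    have h1 : Tendsto (fun k => posOn n (u (ns k)) x) atTop (𝓝 (posOn n v x)) := by
      by_cases hxI : x ∈ Ioo (0 : ℝ) n
      · simp only [posOn, indicator_of_mem hxI]
        exact (ENNReal.continuous_ofReal.tendsto _).comp (hx hxI)
      · simp [posOn, hxI]
    rw [← h1.liminf_eq, liminf_eq_iSup_iInf_of_nat]
    exact tendsto_atTop_iSup (hmono x)
  refine le_of_tendsto' (hτ.fatou G _ hG (classMPos_posOn_Lp v) hlim).2 fun j => ?_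
  refine le_trans (hτ.mono _ _ (hG j) (classMPos_posOn_Lp _) (Eventually.of_forall fun x => ?_))
    (hu (ns j))
  exact iInf₂_le j le_rfl

/-- Hahn–Banach in L²(0,n): a functional, represented by some v, separates f from the ball of τ at a
level s. Then v⁺/s lies in the unit ball of τ' and its pairing with f is at least 1. -/
lemma one_le_assoc_assoc_of_bounded (hτ : IsBanachFunctionNorm τ) {f : ℝ → ℝ≥0∞}
    (hf : ClassMPos f) {n : ℕ} {M : ℝ≥0} (hM : ∀ x, f x ≤ M) (hsupp : ∀ x ∉ Ioo (0 : ℝ) n, f x = 0)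
    (h1 : 1 < τ f) : 1 ≤ assoc (assoc τ) f := by
  set μ := volume.restrict (Ioo (0 : ℝ) n) with hμ
  have hleb : leb.restrict (Ioo (0 : ℝ) n) = μ := leb_restrict Ioo_subset_Ioi_self
  have hac : ∀ {g : ℝ → ℝ≥0∞}, ClassMPos g → AEMeasurable g μ := fun hg =>
    hg.mono_measure (Measure.restrict_mono Ioo_subset_Ioi_self le_rfl)
  have hmem : ∀ {g : ℝ → ℝ≥0∞} {N : ℝ≥0}, AEMeasurable g μ → (∀ x, g x ≤ N) →
      MemLp (fun x => (g x).toReal) 2 μ := fun {g N} hg hN =>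
    MemLp.of_bound hg.ennreal_toReal.aestronglyMeasurable N (Eventually.of_forall fun x => by
      rw [Real.norm_of_nonneg ENNReal.toReal_nonneg]
      exact ENNReal.toReal_le_coe_of_le_coe (hN x))
  have hfL := hmem (hac hf) hM
  have hfnot : hfL.toLp _ ∉ ballLp τ n := by
    refine not_le.2 (lt_of_lt_of_eq h1 (hτ.congr hf (classMPos_posOn_Lp _) ?_))
    have h2 : posOn n (hfL.toLp _) =ᵐ[leb] posOn n fun x => (f x).toReal :=
      posOn_congr hfL.coeFn_toLp
    filter_upwards [h2] with x hx
    rw [hx]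
    by_cases hxI : x ∈ Ioo (0 : ℝ) n
    · simp only [posOn, indicator_of_mem hxI]
      rw [ENNReal.ofReal_toReal ((hM x).trans_lt ENNReal.coe_lt_top).ne]
    · simp [posOn, hxI, hsupp x hxI]
  obtain ⟨L, s, hL, hs⟩ := geometric_hahn_banach_closed_point (convex_ballLp hτ n)
    (isClosed_ballLp hτ n) hfnot
  set v : Lp ℝ 2 μ := (InnerProductSpace.toDual ℝ (Lp ℝ 2 μ)).symm L with hv
  have hLv : ∀ u : Lp ℝ 2 μ, L u = ∫ x, u x * v x ∂μ := by
    intro u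
    have : L u = inner ℝ v u := by rw [hv, InnerProductSpace.toDual_symm_apply]
    rw [this, L2.inner_def]
    rfl
  have hint : ∀ u : Lp ℝ 2 μ, Integrable (fun x => u x * v x) μ := fun u =>
    L2.integrable_inner (𝕜 := ℝ) v u
  have hs0 : 0 < s := by
    have h0 : (0 : Lp ℝ 2 μ) ∈ ballLp τ n := by
      have h2 : posOn n (0 : Lp ℝ 2 μ) =ᵐ[leb] 0 := by
        refine (posOn_congr (Lp.coeFn_zero ℝ 2 μ)).trans (Eventually.of_forall fun x => ?_)
        by_cases hxI : x ∈ Ioo (0 : ℝ) n <;> simp [posOn, hxI]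
      change τ _ ≤ 1
      rw [(hτ.eq_zero_iff _ (classMPos_posOn_Lp _)).2 h2]
      exact zero_le_one
    simpa using hL 0 h0
  have hV : ClassMPos (posOn n v) := classMPos_posOn_Lp v
  have hmulV : ∀ w : ℝ → ℝ≥0∞, ∫⁻ x, w x * posOn n v x ∂leb
      = ∫⁻ x, w x * ENNReal.ofReal (v x) ∂μ := by
    intro w
    have h2 : ∫⁻ x, w x * ENNReal.ofReal (v x) ∂μ = ∫⁻ x,
        (Ioo (0 : ℝ) n).indicator (fun x => w x * ENNReal.ofReal (v x)) x ∂leb := by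
      rw [lintegral_indicator measurableSet_Ioo]
      exact congrArg (fun ν => ∫⁻ x, w x * ENNReal.ofReal (v x) ∂ν) hleb.symm
    rw [h2]
    congr 1; ext x
    by_cases hxI : x ∈ Ioo (0 : ℝ) n <;> simp [posOn, hxI]
  have hball : assoc τ (posOn n v) ≤ ENNReal.ofReal s := by
    refine assoc_le fun w hw hw1 => ?_
    have hsup : ∫⁻ x, w x * posOn n v x ∂leb
        = ⨆ k : ℕ, ∫⁻ x, min (w x) k * posOn n v x ∂leb := by
      rw [← lintegral_iSup' (fun k => ClassMPos.fun_mul (AEMeasurable.min hw aemeasurable_const) hV)]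
      · congr 1; ext x
        rw [← ENNReal.iSup_mul, ← inf_iSup_eq, ENNReal.iSup_natCast, inf_top_eq]
      · refine Eventually.of_forall fun x i j hij => ?_
        dsimp only
        gcongr
    rw [hsup]
    refine iSup_le fun k => ?_
    -- Cutting at height k puts w in L², and discarding the set where v ≤ 0 turns the pairing with
    -- v⁺ into one with v, to which the separation applies.
    set w' : ℝ → ℝ≥0∞ := fun x => if 0 < v x then min (w x) k else 0 with hw'
    have hw'm : AEMeasurable w' μ := by
      have hvm : AEMeasurable v μ := (Lp.aestronglyMeasurable v).aemeasurable
      have : w' = {x | 0 < v x}.indicator fun x => min (w x) k := by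
        ext x; simp [hw', indicator_apply]
      rw [this]
      exact (AEMeasurable.min (hac hw) aemeasurable_const).indicator₀
        (nullMeasurableSet_lt aemeasurable_const hvm)
    have hw'k : ∀ x, w' x ≤ (k : ℝ≥0) := fun x => by
      simp only [hw']; split_ifs <;> simp
    have huL := hmem hw'm hw'k
    have hu : huL.toLp _ ∈ ballLp τ n := by
      refine le_trans (hτ.mono _ _ (classMPos_posOn_Lp _) hw ?_) hw1
      refine (posOn_congr huL.coeFn_toLp).le.trans (Eventually.of_forall fun x => ?_)
      refine indicator_apply_le fun _ => ?_
      rw [ENNReal.ofReal_toReal ((hw'k x).trans_lt ENNReal.coe_lt_top).ne]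
      simp only [hw']; split_ifs <;> simp
    have h2 : ∫⁻ x, min (w x) k * ENNReal.ofReal (v x) ∂μ
        = ∫⁻ x, ENNReal.ofReal (huL.toLp _ x * v x) ∂μ := by
      refine lintegral_congr_ae ?_
      filter_upwards [huL.coeFn_toLp] with x hx
      rw [hx, ENNReal.ofReal_mul ENNReal.toReal_nonneg,
        ENNReal.ofReal_toReal ((hw'k x).trans_lt ENNReal.coe_lt_top).ne]
      by_cases hvx : 0 < v x
      · simp [hw', hvx]
      · simp [ENNReal.ofReal_of_nonpos (not_lt.1 hvx)]
    rw [hmulV, h2, ← ofReal_integral_eq_lintegral_ofReal (hint _), ← hLv]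
    · exact ENNReal.ofReal_le_ofReal (hL _ hu).le
    · filter_upwards [huL.coeFn_toLp] with x hx
      rw [hx]
      by_cases hvx : 0 < v x
      · exact mul_nonneg ENNReal.toReal_nonneg hvx.le
      · simp [hw', hvx]
  have hs0' : ENNReal.ofReal s ≠ 0 := (ENNReal.ofReal_pos.2 hs0).ne'
  have hg1 : assoc τ (fun x => (ENNReal.ofReal s)⁻¹ * posOn n v x) ≤ 1 := by
    rw [assoc_const_mul _ hV, ENNReal.inv_mul_le_iff hs0' ENNReal.ofReal_ne_top, mul_one]
    exact hball
  refine le_trans ?_ (le_assoc (hV.const_mul _) hg1)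
  simp only [mul_assoc]
  rw [lintegral_const_mul'' _ (hV.fun_mul hf), mul_comm, ← div_eq_mul_inv,
    ENNReal.le_div_iff_mul_le (Or.inl hs0') (Or.inl ENNReal.ofReal_ne_top), one_mul]
  simp only [mul_comm (posOn n v _)]
  rw [hmulV]
  have h3 : ∫⁻ x, f x * ENNReal.ofReal (v x) ∂μ
      = ∫⁻ x, ENNReal.ofReal (hfL.toLp _ x * v x) ∂μ := by
    refine lintegral_congr_ae ?_
    filter_upwards [hfL.coeFn_toLp] with x hx
    rw [hx, ENNReal.ofReal_mul ENNReal.toReal_nonneg,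
      ENNReal.ofReal_toReal ((hM x).trans_lt ENNReal.coe_lt_top).ne]
  rw [h3]
  rw [hLv] at hs
  refine (ENNReal.ofReal_le_ofReal hs.le).trans ?_
  rw [integral_eq_lintegral_pos_part_sub_lintegral_neg_part (hint _)]
  refine (ENNReal.ofReal_le_ofReal (sub_le_self _ ENNReal.toReal_nonneg)).trans ?_
  exact ENNReal.ofReal_toReal_le

/-- The Lorentz–Luxemburg theorem (nontrivial inequality). -/
lemma IsBanachFunctionNorm.le_assoc_assoc (hτ : IsBanachFunctionNorm τ) {f : ℝ → ℝ≥0∞}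
    (hf : ClassMPos f) : τ f ≤ RI.assoc (RI.assoc τ) f := by
  by_contra! hlt
  obtain ⟨n, hn⟩ := ((hτ.fatou _ f hf.trunc hf (ae_trunc f)).2.eventually
    (lt_mem_nhds hlt)).exists
  have hlt' : RI.assoc (RI.assoc τ) (trunc f n) < τ (trunc f n) :=
    (assoc_mono (Eventually.of_forall (trunc_le f n))).trans_lt hn
  -- Division by a number strictly between the two norms brings the function outside the unit ball
  -- of τ while keeping its second associate norm below 1.
  obtain ⟨c, hc1, hc2⟩ := ENNReal.lt_iff_exists_nnreal_btwn.1 hlt'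
  have hc0 : (c : ℝ≥0∞) ≠ 0 := (zero_le.trans_lt hc1).ne'
  have hc0' : c ≠ 0 := by simpa using hc0
  have hinv : ((c⁻¹ : ℝ≥0) : ℝ≥0∞) = (c : ℝ≥0∞)⁻¹ := ENNReal.coe_inv hc0'
  have key : 1 ≤ RI.assoc (RI.assoc τ) (fun x => ((c⁻¹ : ℝ≥0) : ℝ≥0∞) * trunc f n x) := by
    refine one_le_assoc_assoc_of_bounded hτ ((hf.trunc n).const_mul _) (n := n)
      (M := c⁻¹ * n) (fun x => ?_) (fun x hx => ?_) ?_
    · push_cast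
      gcongr
      unfold trunc
      exact indicator_apply_le (g := fun _ => (n : ℝ≥0∞)) fun _ => min_le_right _ _
    · simp [trunc, hx]
    · rw [hτ.smul _ (hf.trunc n), hinv, mul_comm, ← div_eq_mul_inv,
        ENNReal.lt_div_iff_mul_lt (Or.inl hc0) (Or.inl ENNReal.coe_ne_top), one_mul]
      exact hc2
  rw [assoc_const_mul _ (hf.trunc n), hinv, mul_comm, ← div_eq_mul_inv,
    ENNReal.le_div_iff_mul_le (Or.inl hc0) (Or.inl ENNReal.coe_ne_top), one_mul] at key
  exact absurd hc1 (not_lt.2 key)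

/-! ### Transplanting functions between sets; associates of r.i. norms are r.i. -/

lemma volume_inter_Iic_lt_top {D : Set ℝ} (hD : D ⊆ Ioi 0) (x : ℝ) : volume (D ∩ Iic x) < ∞ :=
  (measure_mono (show D ∩ Iic x ⊆ Ioc 0 x from fun _ hy => ⟨hD hy.1, hy.2⟩)).trans_lt
    measure_Ioc_lt_top

/-- Intermediate value theorem: x ↦ |D ∩ (-∞, x]| is 1-Lipschitz, vanishes at 0 and eventually
exceeds m. -/
lemma exists_volume_inter_Iic_eq {D : Set ℝ} (hD : D ⊆ Ioi 0) {m : ℝ≥0∞} (hm : m < volume D) :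
    ∃ b, volume (D ∩ Iic b) = m := by
  have hfin := volume_inter_Iic_lt_top hD
  have hLip : LipschitzWith 1 fun x => (volume (D ∩ Iic x)).toReal := by
    refine LipschitzWith.of_le_add fun x y => ?_
    have h1 : volume (D ∩ Iic x) ≤ volume (D ∩ Iic y) + ENNReal.ofReal (dist x y) := by
      have hsub : D ∩ Iic x ⊆ (D ∩ Iic y) ∪ Ioc y x := fun z hz =>
        (le_or_gt z y).imp (fun h => ⟨hz.1, h⟩) fun h => ⟨h, hz.2⟩
      refine (measure_mono hsub).trans ((measure_union_le _ _).trans ?_)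
      rw [Real.volume_Ioc]
      gcongr
      exact le_abs_self _
    have h2 := ENNReal.toReal_mono (ENNReal.add_ne_top.2 ⟨(hfin y).ne, ENNReal.ofReal_ne_top⟩) h1
    rwa [ENNReal.toReal_add (hfin y).ne ENNReal.ofReal_ne_top,
      ENNReal.toReal_ofReal dist_nonneg] at h2
  have hmtop : m ≠ ∞ := hm.ne_top
  have hU : D = ⋃ n : ℕ, D ∩ Iic (n : ℝ) := by
    rw [← inter_iUnion, eq_comm, inter_eq_left]
    exact fun x _ => mem_iUnion.2 (exists_nat_ge x)
  have hmono : Monotone fun n : ℕ => D ∩ Iic (n : ℝ) := fun i j hij =>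
    inter_subset_inter_right _ (Iic_subset_Iic.2 (by exact_mod_cast hij))
  obtain ⟨n, hn⟩ : ∃ n : ℕ, m < volume (D ∩ Iic (n : ℝ)) := by
    rw [hU, hmono.measure_iUnion] at hm
    exact lt_iSup_iff.1 hm
  obtain ⟨b, hb⟩ : m.toReal ∈ range fun x => (volume (D ∩ Iic x)).toReal := by
    refine mem_range_of_exists_le_of_exists_ge hLip.continuous ⟨0, ?_⟩ ⟨n, ?_⟩
    · have : D ∩ Iic 0 = ∅ := by
        ext x
        simp only [mem_inter_iff, mem_Iic, mem_empty_iff_false, iff_false, not_and, not_le]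
        exact fun hx => hD hx
      simp [this]
    · exact ENNReal.toReal_mono (hfin _).ne hn.le
  exact ⟨b, (ENNReal.toReal_eq_toReal_iff' (hfin b).ne hmtop).1 hb⟩

/-- The strict inequality defining the set also covers m = |D|, possibly infinite, where a cutting
point b need not exist; the lower bound is then reached through all m' < m. -/
lemma volume_inter_lt {D : Set ℝ} (hD : D ⊆ Ioi 0) {m : ℝ≥0∞} (hm : m ≤ volume D) :
    volume (D ∩ {x | volume (D ∩ Iic x) < m}) = m := by
  refine le_antisymm ?_ (le_of_forall_lt_imp_le_of_dense fun m' hm' => ?_)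
  · rcases hm.eq_or_lt with rfl | hlt
    · exact measure_mono inter_subset_left
    · obtain ⟨b, hb⟩ := exists_volume_inter_Iic_eq hD hlt
      rw [← hb]
      refine measure_mono fun x hx => ⟨hx.1, ?_⟩
      by_contra hxb
      refine absurd (show volume (D ∩ Iic x) < volume (D ∩ Iic b) from hx.2) (not_lt.2 ?_)
      exact measure_mono (inter_subset_inter_right _ (Iic_subset_Iic.2 (not_le.1 hxb).le))
  · obtain ⟨b, hb⟩ := exists_volume_inter_Iic_eq hD (hm'.trans_le hm)
    refine hb.symm.le.trans (measure_mono fun x hx => ⟨hx.1, lt_of_le_of_lt ?_ hm'⟩)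
    rw [← hb]
    exact measure_mono (inter_subset_inter_right _ (Iic_subset_Iic.2 hx.2))

/-- A function on `C` can be transplanted to any set `D` of the same measure. -/
lemma exists_distrib_indicator_eq {C D : Set ℝ} (hD : D ⊆ Ioi 0)
    (hCD : volume C = volume D) (f : ℝ → ℝ≥0∞) :
    ∃ u : ℝ → ℝ≥0∞, Measurable u ∧ distrib (D.indicator u) = distrib (C.indicator f) := by
  have hmono : Monotone fun x => (volume (D ∩ Iic x)).toReal := fun x y hxy =>
    ENNReal.toReal_mono (volume_inter_Iic_lt_top hD y).ne
      (measure_mono (inter_subset_inter_right _ (Iic_subset_Iic.2 hxy)))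
  -- The map x ↦ |D ∩ (-∞, x]| carries the measure of D to Lebesgue measure on (0, |D|), so
  -- composing it with (f χ_C)^* keeps the distribution.
  refine ⟨fun x => rearr (C.indicator f) (volume (D ∩ Iic x)).toReal,
    (rearr_measurable _).comp hmono.measurable, ?_⟩
  funext l
  rcases eq_or_ne l ∞ with rfl | hl
  · simp [distrib_top]
  set m := distrib (C.indicator f) l with hm
  have hmle : m ≤ volume D := by
    rw [← hCD]
    refine (Measure.restrict_apply_le _ _).trans (measure_mono fun x hx => ?_)
    by_contra hxC
    have hx' : l < C.indicator f x := hx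
    simp [hxC] at hx'
  have hset : {x | l < D.indicator
      (fun x => rearr (C.indicator f) (volume (D ∩ Iic x)).toReal) x}
      = D ∩ {x | volume (D ∩ Iic x) < m} := by
    ext x
    simp only [mem_ofPred_eq, mem_inter_iff]
    by_cases hx : x ∈ D
    · simp only [indicator_of_mem hx, hx, true_and]
      rw [lt_rearr_iff _ _ hl.lt_top, ENNReal.ofReal_toReal (volume_inter_Iic_lt_top hD x).ne]
    · simp [hx]
  conv_lhs => unfold distrib
  rw [hset, Measure.restrict_apply' measurableSet_Ioi,
    inter_eq_left.2 (inter_subset_left.trans hD), volume_inter_lt hD hmle]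

lemma exists_superset_volume_eq {E B : Set ℝ} (hE : MeasurableSet E) (hB : MeasurableSet B)
    (hB0 : B ⊆ Ioi 0) (hEB : E ⊆ B) {m : ℝ≥0∞} (h1 : volume E ≤ m) (h2 : m ≤ volume B)
    (hm : m ≠ ∞) : ∃ E', MeasurableSet E' ∧ E ⊆ E' ∧ E' ⊆ B ∧ volume E' = m := by
  rcases h2.eq_or_lt with h2 | h2
  · exact ⟨B, hB, hEB, subset_rfl, h2.symm⟩
  have hEfin : volume E ≠ ∞ := (h1.trans_lt hm.lt_top).ne
  have hlt : m - volume E < volume (B \ E) := by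
    rw [measure_sdiff hEB hE.nullMeasurableSet hEfin]
    exact (ENNReal.sub_lt_iff_lt_right hEfin h1).2
      (h2.trans_le le_tsub_add)
  obtain ⟨b, hb⟩ := exists_volume_inter_Iic_eq (sdiff_subset.trans hB0) hlt
  refine ⟨E ∪ ((B \ E) ∩ Iic b), hE.union ((hB.diff hE).inter measurableSet_Iic),
    subset_union_left, union_subset hEB (inter_subset_left.trans sdiff_subset), ?_⟩
  rw [measure_union (disjoint_sdiff_right.mono_right inter_subset_left)
    ((hB.diff hE).inter measurableSet_Iic), hb, add_tsub_cancel_of_le h1]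

lemma exists_monotone_volume_eq {B : ℕ → Set ℝ} (hB : ∀ j, MeasurableSet (B j))
    (hB0 : ∀ j, B j ⊆ Ioi 0) (hBm : Monotone B) {m : ℕ → ℝ≥0∞} (hm : Monotone m)
    (hfin : ∀ j, m j ≠ ∞) (hle : ∀ j, m j ≤ volume (B j)) :
    ∃ E : ℕ → Set ℝ, Monotone E ∧ ∀ j, MeasurableSet (E j) ∧ E j ⊆ B j ∧ volume (E j) = m j := by
  let P : ℕ → Set ℝ → Prop := fun j E => MeasurableSet E ∧ E ⊆ B j ∧ volume E = m j
  have base : ∃ E, P 0 E := by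
    obtain ⟨E, h1, -, h2, h3⟩ := exists_superset_volume_eq MeasurableSet.empty (hB 0) (hB0 0)
      (empty_subset _) (by simp) (hle 0) (hfin 0)
    exact ⟨E, h1, h2, h3⟩
  have step : ∀ j (E : {E // P j E}), ∃ E' : {E // P (j + 1) E}, E.1 ⊆ E'.1 := by
    rintro j ⟨E, h1, h2, h3⟩
    obtain ⟨E', k1, k2, k3, k4⟩ := exists_superset_volume_eq h1 (hB (j + 1)) (hB0 _)
      (h2.trans (hBm j.le_succ)) (h3.le.trans (hm j.le_succ)) (hle _) (hfin _)
    exact ⟨⟨E', k1, k3, k4⟩, k2⟩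
  choose next hnext using step
  let seq : ∀ j, {E // P j E} := fun j => Nat.rec ⟨base.choose, base.choose_spec⟩ next j
  exact ⟨fun j => (seq j).1, monotone_nat_of_le_succ fun j => hnext j (seq j), fun j => (seq j).2⟩

lemma tsum_indicator_of_mem {D : ℕ → Set ℝ} (hd : Pairwise (Function.onFun Disjoint D)) (u : ℕ → ℝ → ℝ≥0∞)
    {x : ℝ} {i : ℕ} (hx : x ∈ D i) : ∑' j, (D j).indicator (u j) x = u i x := by
  rw [tsum_eq_single i, indicator_of_mem hx]
  intro j hj
  exact indicator_of_notMem (fun h => Set.disjoint_left.1 (hd hj) h hx) _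

lemma distrib_tsum_indicator {D : ℕ → Set ℝ} (hd : Pairwise (Function.onFun Disjoint D))
    (hD : ∀ j, MeasurableSet (D j)) {u : ℕ → ℝ → ℝ≥0∞} (hu : ∀ j, Measurable (u j)) (l : ℝ≥0∞) :
    distrib (fun x => ∑' j, (D j).indicator (u j) x) l
      = ∑' j, distrib ((D j).indicator (u j)) l := by
  have hsub : ∀ j, {x | l < (D j).indicator (u j) x} ⊆ D j := fun j x hx => by
    by_contra hxD
    have hx' : l < (D j).indicator (u j) x := hx
    simp [hxD] at hx'
  have hset : {x | l < ∑' j, (D j).indicator (u j) x}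
      = ⋃ j, {x | l < (D j).indicator (u j) x} := by
    ext x
    simp only [mem_ofPred_eq, mem_iUnion]
    constructor
    · intro hx
      by_cases hex : ∃ i, x ∈ D i
      · obtain ⟨i, hi⟩ := hex
        refine ⟨i, ?_⟩
        rwa [indicator_of_mem hi, ← tsum_indicator_of_mem hd u hi]
      · push Not at hex
        simp [hex] at hx
    · rintro ⟨i, hi⟩
      exact hi.trans_le (ENNReal.le_tsum i)
  unfold distrib
  rw [hset, measure_iUnion (fun i j hij => (hd hij).mono (hsub i) (hsub j))
    fun j => measurableSet_lt measurable_const ((hu j).indicator (hD j))]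

lemma pairwise_disjoint_sdiff_succ {E : ℕ → Set ℝ} (hE : Monotone E) :
    Pairwise (Function.onFun Disjoint fun j => E (j + 1) \ E j) := by
  rw [pairwise_disjoint_on]
  intro i j hij
  exact Set.disjoint_left.2 fun x hx hx' => hx'.2 (hE (Nat.succ_le_of_lt hij) hx.1)

/-- Cut g along the geometric levels L_j = M θ^j into layers C_j on which L_{j+1} < g ≤ L_j. As h
has the larger distribution function, nested sets E_j ⊆ {h > L_j} exist with |E_j| = |{g > L_j}|,
and D_j = E_{j+1} \ E_j has the measure of C_j. Moving f from each C_j to D_j gives F with τ(F) ≤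
τ(f). On D_j, h exceeds L_{j+1} = θ L_j, whence θ ∫ f g ≤ ∫ F h. -/
lemma mul_lintegral_le_assoc (hτ : IsRINorm τ) {f g h : ℝ → ℝ≥0∞} (hf : Measurable f)
    (hg : Measurable g) (hh : Measurable h) (hτf : τ f ≤ 1) {M : ℝ≥0} (hgM : ∀ x, g x ≤ M)
    (hg0 : distrib g 0 ≠ ∞) (hgh : ∀ l, distrib g l ≤ distrib h l) {θ : ℝ≥0}
    (hθ1 : θ < 1) :
    θ * ∫⁻ x, f x * g x ∂leb ≤ assoc τ h := by
  let L : ℕ → ℝ≥0∞ := fun j => M * (θ : ℝ≥0∞) ^ j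
  have hL : Antitone L := fun i j hij =>
    mul_le_mul_right (pow_le_pow_right_of_le_one' (by exact_mod_cast hθ1.le) hij) _
  let lev : (ℝ → ℝ≥0∞) → ℕ → Set ℝ := fun k j => {x | L j < k x} ∩ Ioi 0
  have hlev : ∀ {k}, Measurable k → ∀ j, MeasurableSet (lev k j) := fun hk j =>
    (measurableSet_lt measurable_const hk).inter measurableSet_Ioi
  have hlevm : ∀ k, Monotone (lev k) := fun k i j hij x hx => ⟨(hL hij).trans_lt hx.1, hx.2⟩
  have hlevd : ∀ {k}, Measurable k → ∀ j, volume (lev k j) = distrib k (L j) := fun hk j =>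
    (Measure.restrict_apply (measurableSet_lt measurable_const hk)).symm
  have hfin : ∀ j, volume (lev g j) ≠ ∞ := fun j => by
    rw [hlevd hg]
    exact ((distrib_anti g zero_le).trans_lt hg0.lt_top).ne
  obtain ⟨E, hEm, hE⟩ := exists_monotone_volume_eq (hlev hh) (fun j => inter_subset_right)
    (hlevm h) (m := fun j => volume (lev g j)) (fun i j hij => measure_mono (hlevm g hij)) hfin
    (fun j => by rw [hlevd hg, hlevd hh]; exact hgh _)
  let C : ℕ → Set ℝ := fun j => lev g (j + 1) \ lev g j
  let D : ℕ → Set ℝ := fun j => E (j + 1) \ E j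
  have hCm : ∀ j, MeasurableSet (C j) := fun j => (hlev hg _).diff (hlev hg _)
  have hDm : ∀ j, MeasurableSet (D j) := fun j => (hE _).1.diff (hE _).1
  have hCd : Pairwise (Function.onFun Disjoint C) := pairwise_disjoint_sdiff_succ (hlevm g)
  have hDd : Pairwise (Function.onFun Disjoint D) := pairwise_disjoint_sdiff_succ hEm
  have hD0 : ∀ j, D j ⊆ Ioi 0 := fun j x hx => ((hE _).2.1 hx.1).2
  have hvol : ∀ j, volume (C j) = volume (D j) := fun j => by
    rw [measure_sdiff (hlevm g j.le_succ) (hlev hg _).nullMeasurableSet (hfin _),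
      measure_sdiff (hEm j.le_succ) (hE _).1.nullMeasurableSet (by rw [(hE _).2.2]; exact hfin _),
      (hE _).2.2, (hE _).2.2]
  choose u hum hud using fun j => exists_distrib_indicator_eq (hD0 j) (hvol j) f
  have hDu : ∀ j, Measurable ((D j).indicator (u j)) := fun j => (hum j).indicator (hDm j)
  have hCf : ∀ j, Measurable ((C j).indicator f) := fun j => hf.indicator (hCm j)
  let F : ℝ → ℝ≥0∞ := fun x => ∑' j, (D j).indicator (u j) x
  have hF : ClassMPos F := (Measurable.tsum hDu).aemeasurable
  have hτF : τ F ≤ 1 := by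
    have hG : ClassMPos fun x => ∑' j, (C j).indicator f x :=
      (Measurable.tsum hCf).aemeasurable
    have hd : distrib F = distrib fun x => ∑' j, (C j).indicator f x := by
      funext l
      rw [distrib_tsum_indicator hDd hDm hum, distrib_tsum_indicator hCd hCm fun _ => hf]
      simp only [hud]
    rw [hτ.rearr_inv F _ hF hG fun t _ => by rw [rearr_congr hd]]
    refine (hτ.mono _ _ hG hf.aemeasurable (Eventually.of_forall fun x => ?_)).trans hτf
    by_cases hex : ∃ i, x ∈ C i
    · obtain ⟨i, hi⟩ := hex
      exact (tsum_indicator_of_mem hCd (fun _ => f) hi).le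
    · push Not at hex
      simp [hex]
  calc (θ : ℝ≥0∞) * ∫⁻ x, f x * g x ∂leb
      ≤ θ * ∫⁻ x, ∑' j, L j * (C j).indicator f x ∂leb := by
        refine mul_le_mul_right (lintegral_mono_ae ?_) _
        filter_upwards [ae_restrict_mem measurableSet_Ioi] with x hx
        rcases eq_or_ne (g x) 0 with h0 | h0
        · simp [h0]
        have hex : ∃ j, L j < g x := by
          have hlim : Tendsto L atTop (𝓝 (M * 0)) :=
            ENNReal.Tendsto.const_mul (ENNReal.tendsto_pow_atTop_nhds_zero_of_lt_one
              (by exact_mod_cast hθ1)) (Or.inr ENNReal.coe_ne_top)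
          rw [mul_zero] at hlim
          exact (hlim.eventually (gt_mem_nhds (pos_iff_ne_zero.2 h0))).exists
        classical
        -- The first level below g(x) is not L_0 = M, since g ≤ M; so x lies in the layer just
        -- before that index.
        obtain ⟨i, hi⟩ : ∃ i, Nat.find hex = i + 1 := by
          refine Nat.exists_eq_succ_of_ne_zero fun hz => ?_
          have := Nat.find_spec hex
          rw [hz] at this
          simp only [L, pow_zero, mul_one] at this
          exact absurd (hgM x) (not_le.2 this)
        have h1 : L (i + 1) < g x := hi ▸ Nat.find_spec hex
        have h2 : ¬ L i < g x := Nat.find_min hex (by omega)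
        have hxC : x ∈ C i := ⟨⟨h1, hx⟩, fun h => h2 h.1⟩
        refine le_trans ?_ (ENNReal.le_tsum i)
        rw [indicator_of_mem hxC, mul_comm]
        exact mul_le_mul_left (not_lt.1 h2) _
    _ = ∫⁻ x, ∑' j, L (j + 1) * (D j).indicator (u j) x ∂leb := by
        rw [lintegral_tsum fun j => ((hCf j).const_mul _).aemeasurable,
          lintegral_tsum fun j => ((hDu j).const_mul _).aemeasurable, ← ENNReal.tsum_mul_left]
        refine tsum_congr fun j => ?_
        rw [lintegral_const_mul _ (hCf j), lintegral_const_mul _ (hDu j),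
          lintegral_eq_of_distrib_eq (hDu j).aemeasurable (hCf j).aemeasurable (hud j)]
        simp only [L]
        ring
    _ ≤ ∫⁻ x, F x * h x ∂leb := by
        refine lintegral_mono fun x => ?_
        simp only [F]
        rw [← ENNReal.tsum_mul_right]
        refine ENNReal.tsum_le_tsum fun j => ?_
        by_cases hx : x ∈ D j
        · rw [indicator_of_mem hx, mul_comm]
          exact mul_le_mul_right ((hE _).2.1 hx.1).1.le _
        · simp [hx]
    _ ≤ assoc τ h := le_assoc hF hτF

/-- The associate norm of an r.i. norm is monotone with respect to distribution functions. -/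
lemma assoc_le_assoc_of_distrib_le (hτ : IsRINorm τ) {g h : ℝ → ℝ≥0∞} (hg : ClassMPos g)
    (hh : ClassMPos h) (hgh : ∀ l, distrib g l ≤ distrib h l) : assoc τ g ≤ assoc τ h := by
  have key : ∀ {g h : ℝ → ℝ≥0∞}, Measurable g → Measurable h →
      (∀ l, distrib g l ≤ distrib h l) → assoc τ g ≤ assoc τ h := by
    intro g h hg hh hgh
    -- Truncation supplies the boundedness and finite support needed for the layers; afterwards θ
    -- tends to 1.
    rw [assoc_eq_iSup (fun n => ClassMPos.trunc hg.aemeasurable n) (ae_trunc g)]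
    refine iSup_le fun n => assoc_le fun f hf hf1 => ?_
    refine ENNReal.le_of_forall_lt_one_mul_le fun θ hθ => ?_
    lift θ to ℝ≥0 using hθ.ne_top
    have h1 : ∫⁻ x, f x * trunc g n x ∂leb = ∫⁻ x, hf.mk f x * trunc g n x ∂leb :=
      lintegral_congr_ae (by filter_upwards [hf.ae_eq_mk] with x hx; rw [hx])
    have h2 : τ (hf.mk f) ≤ 1 :=
      (hτ.congr hf hf.measurable_mk.aemeasurable hf.ae_eq_mk).symm.le.trans hf1
    rw [h1]
    refine mul_lintegral_le_assoc hτ hf.measurable_mk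
      ((hg.min measurable_const).indicator measurableSet_Ioo) hh h2 (M := n) (fun x => ?_)
      ?_ (fun l => (distrib_mono (Eventually.of_forall (trunc_le g n)) l).trans (hgh l)) (by exact_mod_cast hθ)
    · exact indicator_apply_le (g := fun _ => ((n : ℝ≥0) : ℝ≥0∞)) fun _ => by simp
    · refine ne_top_of_le_ne_top (measure_Ioo_lt_top (a := (0 : ℝ)) (b := n)).ne
        ((Measure.restrict_apply_le _ _).trans (measure_mono fun x hx => ?_))
      by_contra hxI
      have hx' : 0 < trunc g n x := hx
      simp [trunc, hxI] at hx'
  rw [assoc_congr hg.ae_eq_mk, assoc_congr hh.ae_eq_mk]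
  refine key hg.measurable_mk hh.measurable_mk fun l => ?_
  rw [← distrib_congr hg.ae_eq_mk, ← distrib_congr hh.ae_eq_mk]
  exact hgh l

lemma assoc_eq_assoc_of_distrib_eq (hτ : IsRINorm τ) {g h : ℝ → ℝ≥0∞} (hg : ClassMPos g)
    (hh : ClassMPos h) (hgh : distrib g = distrib h) : assoc τ g = assoc τ h :=
  le_antisymm (assoc_le_assoc_of_distrib_le hτ hg hh fun l => (congrFun hgh l).le)
    (assoc_le_assoc_of_distrib_le hτ hh hg fun l => (congrFun hgh l).ge)

/-- The associate norm of an r.i. norm is an r.i. norm. -/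
lemma IsRINorm.assoc (hτ : IsRINorm τ) : IsRINorm (assoc τ) :=
  { hτ.toIsBanachFunctionNorm.assoc with
    rearr_inv := fun _ _ hf hg h =>
      assoc_eq_assoc_of_distrib_eq hτ hf hg (distrib_eq_of_rearr_eq h) }

/-! ### The functional `rhoAlpha` as an r.i. norm. -/

/-- The levels 0 and 1 in the K-functional give the bounds |G| and 1/t. -/
lemma alpha_indicator_le {G : Set ℝ} (hG : G ⊆ Ioi 0) (hm : NullMeasurableSet G volume)
    {t : ℝ} (ht : 0 < t) :
    alpha (G.indicator 1) t ≤ max 1 (volume G) * ENNReal.ofReal (min 1 (1 / t)) := by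
  have hcm := classMPos_indicator_one hm
  rcases le_total 1 (1 / t) with h | h
  · rw [min_eq_left h, ENNReal.ofReal_one, mul_one, alpha_eq hcm ht]
    refine (iInf_le _ 0).trans ?_
    have := lintegral_mul_indicator_one 1 hG hm
    simp only [Pi.one_apply, one_mul, setLIntegral_one] at this
    simp [this]
  · rw [min_eq_right h, alpha_eq hcm ht]
    refine (iInf_le _ 1).trans ?_
    have h0 : ∀ x, G.indicator (1 : ℝ → ℝ≥0∞) x - ((1 : ℝ≥0) : ℝ≥0∞) = 0 := fun x =>
      tsub_eq_zero_of_le (indicator_apply_le' (fun _ => le_rfl) fun _ => zero_le)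
    simp only [h0, lintegral_zero, add_zero]
    gcongr
    exact le_max_left _ _

lemma le_alpha_indicator_Ioo {t : ℝ} (ht : 0 < t) :
    ENNReal.ofReal (min 1 (1 / t)) ≤ alpha ((Ioo (0 : ℝ) 1).indicator 1) t := by
  refine le_trans (le_of_eq ?_) (setLIntegral_le_alpha (G := Ioo 0 (min 1 (1 / t)))
    (classMPos_indicator_one measurableSet_Ioo.nullMeasurableSet) Ioo_subset_Ioi_self ht
    (by rw [Real.volume_Ioo, sub_zero]; exact ENNReal.ofReal_le_ofReal (min_le_right _ _)))
  rw [setLIntegral_congr_fun measurableSet_Ioo (g := fun _ => 1) fun x hx =>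
    indicator_of_mem (show x ∈ Ioo (0 : ℝ) 1 from ⟨hx.1, hx.2.trans_le (min_le_left _ _)⟩) _]
  rw [setLIntegral_one, Real.volume_Ioo, sub_zero]

lemma assoc_abs_minOneInv (Y : (ℝ → ℝ≥0∞) → ℝ≥0∞) :
    norm (assoc Y) minOneInv = assoc Y fun t => ENNReal.ofReal (min 1 (1 / t)) := by
  refine assoc_congr ?_
  filter_upwards [ae_restrict_mem measurableSet_Ioi] with t ht
  have ht' : (0 : ℝ) < t := ht
  rw [minOneInv, EReal.abs_def, abs_of_pos (by positivity)]

lemma classMPos_minOneInv : ClassMPos fun t => ENNReal.ofReal (min 1 (1 / t)) := by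
  have : Measurable fun t : ℝ => ENNReal.ofReal (min 1 (1 / t)) := by fun_prop
  exact this.aemeasurable

lemma minOneInv_mem_space_iff (Y : (ℝ → ℝ≥0∞) → ℝ≥0∞) : minOneInv ∈ space (assoc Y) ↔
    assoc Y (fun t => ENNReal.ofReal (min 1 (1 / t))) < ∞ := by
  have : Measurable fun t : ℝ => ((min 1 (1 / t) : ℝ) : EReal) :=
    Measurable.coe_real_ereal (by fun_prop)
  rw [← assoc_abs_minOneInv]
  exact and_iff_right this.aemeasurable

variable {Y : (ℝ → ℝ≥0∞) → ℝ≥0∞}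

/-- Integrals over sets of finite measure are controlled by `rhoAlpha Y`. -/
lemma setLIntegral_le_rhoAlpha (hY : IsBanachFunctionNorm Y) {G : Set ℝ} (hG : G ⊆ Ioi 0)
    (hfin : volume G < ∞) :
    ∃ C : ℝ≥0, ∀ f, ClassMPos f → ∫⁻ x in G, f x ≤ C * rhoAlpha Y f := by
  -- The added 1 keeps r positive when G is null. For t < 1/r, α(f)(t) dominates ∫_G f, so (∫_G f)
  -- χ_(0,1/r) ≤ α(f), and applying Y' yields the constant 1/Y'(χ_(0,1/r)).
  set r : ℝ := (volume G).toReal + 1 with hr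
  have hr0 : 0 < r := by positivity
  have hGr : volume G ≤ ENNReal.ofReal r := by
    rw [← ENNReal.ofReal_toReal hfin.ne]
    exact ENNReal.ofReal_le_ofReal (by linarith)
  set I : Set ℝ := Ioo 0 (1 / r) with hI
  have hIm : NullMeasurableSet I volume := measurableSet_Ioo.nullMeasurableSet
  have hχ : ClassMPos (I.indicator 1) := classMPos_indicator_one hIm
  set k := assoc Y (I.indicator 1) with hk
  have hk0 : k ≠ 0 := fun h0 => by
    have h1 := (hY.assoc.eq_zero_iff _ hχ).1 h0
    have h2 := lintegral_mul_indicator_one 1 Ioo_subset_Ioi_self hIm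
    rw [lintegral_congr_ae (g := fun _ => 0)
      (by filter_upwards [h1] with x hx; rw [← hI, hx]; simp)] at h2
    have h3 : r ≤ 0 := by simpa using h2.symm
    exact absurd hr0 (not_lt.2 h3)
  have hkt : k ≠ ∞ := (hY.assoc.indicator_lt_top I Ioo_subset_Ioi_self hIm (by simp [hI])).ne
  refine ⟨k⁻¹.toNNReal, fun f hf => ?_⟩
  rw [ENNReal.coe_toNNReal (ENNReal.inv_ne_top.2 hk0)]
  have hle : (∫⁻ x in G, f x) * k ≤ rhoAlpha Y f := by
    rw [hk, ← assoc_const_mul _ hχ]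
    refine assoc_mono ?_
    filter_upwards [ae_restrict_mem measurableSet_Ioi] with t ht
    by_cases htI : t ∈ I
    · rw [indicator_of_mem htI, Pi.one_apply, mul_one]
      refine setLIntegral_le_alpha hf hG ht (hGr.trans (ENNReal.ofReal_le_ofReal ?_))
      rw [le_one_div hr0 ht]
      exact htI.2.le
    · simp [htI]
  rw [mul_comm, ← div_eq_mul_inv, ENNReal.le_div_iff_mul_le (Or.inl hk0) (Or.inl hkt)]
  exact hle

/-- The axioms pass through α to Y'; the condition on min{1, 1/t} enters only in (P4). -/
lemma isRINorm_rhoAlpha (hY : IsBanachFunctionNorm Y)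
    (h : assoc Y (fun t => ENNReal.ofReal (min 1 (1 / t))) < ∞) : IsRINorm (rhoAlpha Y) where
  eq_zero_iff f hf := by
    constructor
    · intro h0
      refine ae_eq_zero_of_setLIntegral_Ioo hf fun n => ?_
      obtain ⟨C, hC⟩ := setLIntegral_le_rhoAlpha hY (G := Ioo (0 : ℝ) n) Ioo_subset_Ioi_self
        (by simp)
      simpa [h0] using hC f hf
    · intro h0
      refine (hY.assoc.eq_zero_iff _ (classMPos_alpha f)).2 ?_
      filter_upwards [ae_restrict_mem measurableSet_Ioi] with t ht
      rw [alpha_eq hf ht, Pi.zero_apply]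
      refine le_antisymm ((iInf_le _ 0).trans ?_) zero_le
      rw [lintegral_congr_ae (g := fun _ => 0)
        (by filter_upwards [h0] with x hx; simp [hx])]
      simp
  smul f hf c := by
    have : alpha (fun x => (c : ℝ≥0∞) * f x) = fun t => c * alpha f t :=
      funext fun t => alpha_const_mul f c t
    rw [rhoAlpha, this, assoc_const_mul _ (classMPos_alpha f)]
    rfl
  add_le f g hf hg := by
    refine le_trans (assoc_mono ?_) (assoc_add_le (classMPos_alpha f))
    filter_upwards [ae_restrict_mem measurableSet_Ioi] with t ht using alpha_add_le hf hg ht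
  mono f g _ _ hfg := assoc_mono (Eventually.of_forall (alpha_mono hfg))
  fatou F f hF hf hFf := by
    refine hY.assoc.fatou (fun j => alpha (F j)) (alpha f) (fun j => classMPos_alpha _)
      (classMPos_alpha f) (Eventually.of_forall fun t => ?_)
    have hm : Monotone fun j => alpha (F j) t := fun i j hij => alpha_mono (by
      filter_upwards [hFf] with x hx using hx.1 hij) t
    refine ⟨hm, ?_⟩
    rw [alpha_eq_iSup hFf]
    exact tendsto_atTop_iSup hm
  indicator_lt_top G hG hm hfin := by
    refine lt_of_le_of_lt (b := max 1 (volume G) *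
      assoc Y (fun t => ENNReal.ofReal (min 1 (1 / t)))) ?_ (ENNReal.mul_lt_top (by simp [hfin]) h)
    rw [← assoc_const_mul _ classMPos_minOneInv]
    refine assoc_mono ?_
    filter_upwards [ae_restrict_mem measurableSet_Ioi] with t ht using alpha_indicator_le hG hm ht
  setLIntegral_le G hG _ hfin := setLIntegral_le_rhoAlpha hY hG hfin
  rearr_inv f g _ _ hfg := by
    unfold rhoAlpha alpha
    rw [rearr_congr (distrib_eq_of_rearr_eq hfg)]

/-! ### The operator `S_a` on non-negative functions and its comparison with α. -/

/-- The operator `S_a` on non-negative functions. -/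
noncomputable def SNonneg (a φ : ℝ → ℝ≥0∞) (t : ℝ) : ℝ≥0∞ := ∫⁻ s, a (s * t) * φ s ∂leb

variable {a : ℝ → ℝ≥0∞}

/-- Monotonicity of `a` is known only on (0,∞). There `a` agrees with (a ∘ exp) ∘ log, which is
Borel because a ∘ exp is antitone on the whole line. -/
lemma aemeasurable_kernel (ha : AntitoneOn a (Ioi 0)) :
    AEMeasurable (fun p : ℝ × ℝ => a (p.1 * p.2)) (leb.prod leb) := by
  have hexp : Antitone (a ∘ Real.exp) := fun x y hxy =>
    ha (Real.exp_pos x) (Real.exp_pos y) (Real.exp_le_exp.2 hxy)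
  have hb : Measurable fun x => (a ∘ Real.exp) (Real.log x) :=
    hexp.measurable.comp Real.measurable_log
  refine ⟨_, hb.comp (measurable_fst.mul measurable_snd), ?_⟩
  rw [leb, Measure.prod_restrict]
  filter_upwards [ae_restrict_mem (measurableSet_Ioi.prod measurableSet_Ioi)] with p hp
  exact congrArg a (Real.exp_log (mul_pos hp.1 hp.2)).symm

lemma aemeasurable_comp_mul_right (ha : AntitoneOn a (Ioi 0)) {t : ℝ} (ht : 0 < t) :
    AEMeasurable (fun s => a (s * t)) leb :=
  aemeasurable_restrict_of_antitoneOn measurableSet_Ioi fun _ hx _ hy hxy =>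
    ha (mul_pos hx ht) (mul_pos hy ht) (mul_le_mul_of_nonneg_right hxy ht.le)

lemma classMPos_SNonneg (ha : AntitoneOn a (Ioi 0)) {φ : ℝ → ℝ≥0∞} (hφ : ClassMPos φ) :
    ClassMPos (SNonneg a φ) := by
  have h : AEMeasurable (fun p : ℝ × ℝ => a (p.2 * p.1) * φ p.2) (leb.prod leb) := by
    simp only [mul_comm (Prod.snd _)]
    exact AEMeasurable.mul (aemeasurable_kernel ha) hφ.comp_snd
  exact h.lintegral_prod_right'

lemma lintegral_SNonneg_mul (ha : AntitoneOn a (Ioi 0)) {φ g : ℝ → ℝ≥0∞} (hφ : ClassMPos φ)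
    (hg : ClassMPos g) :
    ∫⁻ t, SNonneg a φ t * g t ∂leb = ∫⁻ s, φ s * SNonneg a g s ∂leb := by
  have hk : ∀ {ψ : ℝ → ℝ≥0∞}, ClassMPos ψ → ∀ᵐ t ∂leb,
      AEMeasurable (fun s => a (s * t) * ψ s) leb := by
    intro ψ hψ
    filter_upwards [ae_restrict_mem measurableSet_Ioi] with t ht
    exact AEMeasurable.mul (aemeasurable_comp_mul_right ha ht) hψ
  have h1 : ∫⁻ t, SNonneg a φ t * g t ∂leb
      = ∫⁻ t, ∫⁻ s, a (s * t) * φ s * g t ∂leb ∂leb := by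
    refine lintegral_congr_ae ?_
    filter_upwards [hk hφ] with t ht
    rw [lintegral_mul_const'' _ ht]
    rfl
  have h2 : ∫⁻ s, φ s * SNonneg a g s ∂leb
      = ∫⁻ s, ∫⁻ t, a (s * t) * φ s * g t ∂leb ∂leb := by
    refine lintegral_congr_ae ?_
    filter_upwards [hk hg] with s hs
    unfold SNonneg
    rw [← lintegral_const_mul'' _ hs]
    refine lintegral_congr fun t => ?_
    rw [mul_comm t s]
    ring
  rw [h1, h2, lintegral_lintegral_swap]
  have h3 : AEMeasurable (fun p : ℝ × ℝ => a (p.1 * p.2) * φ p.2 * g p.1) (leb.prod leb) :=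
    AEMeasurable.mul (AEMeasurable.mul (aemeasurable_kernel ha) hφ.comp_snd) hg.comp_fst
  refine h3.congr (Eventually.of_forall fun p => ?_)
  simp only [Function.uncurry, mul_comm p.1 p.2]

lemma lintegral_leb_comp_mul_right (F : ℝ → ℝ≥0∞) {s : ℝ} (hs : 0 < s) :
    ∫⁻ t, F (t * s) ∂leb = ENNReal.ofReal (1 / s) * ∫⁻ t, F t ∂leb := by
  have he : MeasurableEmbedding fun t : ℝ => t * s :=
    (Homeomorph.mulRight₀ s hs.ne').measurableEmbedding
  have h1 : ∫⁻ t, F (t * s) ∂leb = ∫⁻ t, (Ioi 0).indicator F (t * s) := by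
    rw [← lintegral_indicator measurableSet_Ioi]
    congr 1; ext t
    by_cases ht : 0 < t
    · rw [indicator_of_mem (mem_Ioi.2 ht), indicator_of_mem (mem_Ioi.2 (mul_pos ht hs))]
    · rw [indicator_of_notMem (by exact ht), indicator_of_notMem]
      exact not_lt.2 (mul_nonpos_of_nonpos_of_nonneg (not_lt.1 ht) hs.le)
  rw [h1, ← he.lintegral_map (fun t => (Ioi 0).indicator F t), Real.map_volume_mul_right hs.ne',
    lintegral_smul_measure, lintegral_indicator measurableSet_Ioi, abs_of_pos (inv_pos.2 hs),
    one_div, smul_eq_mul]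

/-- Split g ≤ l + (g - l)₊: the constant contributes l‖a‖₁/t, the excess at most M ∫ (g - l)₊.
Taking the infimum over l gives α with constant ‖a‖₁ + M. -/
lemma SNonneg_le_alpha {M : ℝ≥0} (hM : ∀ x, 0 < x → a x ≤ M) (ha1 : ∫⁻ x, a x ∂leb ≠ ∞)
    (ha : AntitoneOn a (Ioi 0)) :
    ∃ C : ℝ≥0, ∀ g, ClassMPos g → ∀ t, 0 < t → SNonneg a g t ≤ C * alpha g t := by
  obtain ⟨I, hI⟩ : ∃ I : ℝ≥0, (I : ℝ≥0∞) = ∫⁻ x, a x ∂leb := ⟨_, ENNReal.coe_toNNReal ha1⟩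
  refine ⟨I + M, fun g hg t ht => ?_⟩
  rw [alpha_eq hg ht, ENNReal.mul_iInf (fun h => by simp at h)]
  refine le_iInf fun l => ?_
  have hat := aemeasurable_comp_mul_right ha ht
  calc SNonneg a g t ≤ ∫⁻ s, (a (s * t) * l + M * (g s - l)) ∂leb := by
        refine lintegral_mono_ae ?_
        filter_upwards [ae_restrict_mem measurableSet_Ioi] with s hs
        calc a (s * t) * g s ≤ a (s * t) * (l + (g s - l)) := by gcongr; exact le_add_tsub
          _ = a (s * t) * l + a (s * t) * (g s - l) := mul_add _ _ _
          _ ≤ _ := by gcongr; exact hM _ (mul_pos hs ht)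
    _ = ENNReal.ofReal (1 / t) * I * l + M * ∫⁻ s, (g s - l) ∂leb := by
        rw [lintegral_add_left' (hat.mul_const _), lintegral_mul_const'' _ hat,
          lintegral_const_mul' _ _ ENNReal.coe_ne_top, lintegral_leb_comp_mul_right a ht, hI]
    _ ≤ ENNReal.ofReal (1 / t) * (I + M) * l + (I + M) * ∫⁻ s, (g s - l) ∂leb := by
        gcongr
        · exact le_self_add
        · exact le_add_self
    _ = _ := by push_cast; ring

/-- On (0, c/t) the kernel is at least a(c), and ∫₀^{c/t} g^* ≥ c ∫₀^{1/t} g^* for c ≤ 1, as is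
visible from the K-functional. -/
lemma mul_alpha_le_SNonneg_rearr (ha : AntitoneOn a (Ioi 0)) {c : ℝ} (hc0 : 0 < c) (hc1 : c ≤ 1)
    {g : ℝ → ℝ≥0∞} (hg : ClassMPos g) {t : ℝ} (ht : 0 < t) :
    a c * ENNReal.ofReal c * alpha g t ≤ SNonneg a (rearr g) t := by
  have h1 : ENNReal.ofReal c * alpha g t ≤ ∫⁻ s in Ioo 0 (c / t), rearr g s := by
    rw [alpha_eq hg ht, setLIntegral_rearr hg (div_pos hc0 ht)]
    refine le_iInf fun l => (mul_le_mul_right (iInf_le _ l) _).trans ?_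
    rw [mul_add]
    refine add_le_add (le_of_eq ?_) ?_
    · rw [mul_left_comm, ← ENNReal.ofReal_mul hc0.le, mul_one_div]
    · exact mul_le_of_le_one_left' (by simpa using hc1)
  calc a c * ENNReal.ofReal c * alpha g t ≤ a c * ∫⁻ s in Ioo 0 (c / t), rearr g s := by
        rw [mul_assoc]; gcongr
    _ = ∫⁻ s in Ioo 0 (c / t), a c * rearr g s :=
        (lintegral_const_mul _ (rearr_measurable g)).symm
    _ ≤ ∫⁻ s in Ioo 0 (c / t), a (s * t) * rearr g s := by
        refine lintegral_mono_ae ?_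
        filter_upwards [ae_restrict_mem measurableSet_Ioo] with s hs
        gcongr
        refine ha (mul_pos hs.1 ht) hc0 ?_
        exact ((lt_div_iff₀ ht).1 hs.2).le
    _ ≤ _ := lintegral_mono_set Ioo_subset_Ioi_self

/-- By monotonicity, exceeding the essential supremum at x would mean exceeding it on all of (0, x).
-/
lemma exists_forall_le_of_memLp_top (ha_top : MemLp a ∞ leb) (ha : AntitoneOn a (Ioi 0)) :
    ∃ M : ℝ≥0, ∀ x, 0 < x → a x ≤ M := by
  have hfin : eLpNormEssSup a leb < ∞ := by
    have := ha_top.2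
    rwa [eLpNorm_exponent_top] at this
  refine ⟨(eLpNormEssSup a leb).toNNReal, fun x hx => ?_⟩
  rw [ENNReal.coe_toNNReal hfin.ne]
  have hae : ∀ᵐ y ∂leb, a y ≤ eLpNormEssSup a leb := by
    simpa using enorm_ae_le_eLpNormEssSup a leb
  by_contra! hlt
  have h0 : leb {y | ¬ a y ≤ eLpNormEssSup a leb} = 0 := hae
  have hsub : Ioo 0 x ⊆ {y | ¬ a y ≤ eLpNormEssSup a leb} := fun y hy =>
    not_le.2 (hlt.trans_le (ha hy.1 hx hy.2.le))
  have h1 := measure_mono_null hsub h0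
  rw [Measure.restrict_apply measurableSet_Ioo, inter_eq_left.2 Ioo_subset_Ioi_self,
    Real.volume_Ioo, sub_zero, ENNReal.ofReal_eq_zero] at h1
  exact absurd hx (not_lt.2 h1)

lemma exists_pos_of_not_ae_zero (ha : AntitoneOn a (Ioi 0)) (h : ¬ a =ᵐ[leb] 0) :
    ∃ c : ℝ, 0 < c ∧ c ≤ 1 ∧ a c ≠ 0 := by
  by_contra! h0
  refine h ?_
  filter_upwards [ae_restrict_mem measurableSet_Ioi] with x hx
  have hm : 0 < min x 1 := lt_min hx one_pos
  refine le_antisymm ((ha hm hx (min_le_left _ _)).trans ?_) zero_le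
  rw [h0 _ hm (min_le_right _ _)]
  rfl

/-! ### Signed functions, boundedness of `S_a` and duality. -/

lemma classMPos_abs {f : ℝ → EReal} (hf : ClassM f) : ClassMPos fun x => (f x).abs := by
  have : Measurable EReal.abs := EReal.measurable_of_measurable_real (by
    simp only [EReal.abs_def]; fun_prop)
  exact this.comp_aemeasurable hf

lemma toENNReal_le_abs (x : EReal) : x.toENNReal ≤ x.abs := by
  induction x with
  | bot => simp
  | top => simp
  | coe x =>
    rw [EReal.abs_def, EReal.toENNReal_of_ne_top (EReal.coe_ne_top x), EReal.toReal_coe]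
    exact ENNReal.ofReal_le_ofReal (le_abs_self x)

lemma abs_coe_ennreal (p : ℝ≥0∞) : (p : EReal).abs = p := by
  induction p with
  | top => rfl
  | coe p =>
    change (((p : ℝ) : EReal)).abs = p
    rw [EReal.abs_def, abs_of_nonneg p.coe_nonneg, ENNReal.ofReal_coe_nnreal]

lemma abs_coe_sub_coe_le (p q : ℝ≥0∞) : ((p : EReal) - (q : EReal)).abs ≤ p + q := by
  induction p with
  | top => simp
  | coe p =>
    induction q with
    | top => simp
    | coe q =>
      change (((p : ℝ) : EReal) - ((q : ℝ) : EReal)).abs ≤ _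
      rw [← EReal.coe_sub, EReal.abs_def]
      refine (ENNReal.ofReal_le_ofReal (abs_sub (p : ℝ) q)).trans ?_
      rw [abs_of_nonneg p.coe_nonneg, abs_of_nonneg q.coe_nonneg,
        ENNReal.ofReal_add p.coe_nonneg q.coe_nonneg,
        ENNReal.ofReal_coe_nnreal, ENNReal.ofReal_coe_nnreal]

lemma IsBanachFunctionNorm.ae_lt_top {σ : (ℝ → ℝ≥0∞) → ℝ≥0∞} (hσ : IsBanachFunctionNorm σ)
    {g : ℝ → ℝ≥0∞} (hg : ClassMPos g) (h : σ g < ∞) : ∀ᵐ x ∂leb, g x < ∞ := by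
  have hU : Ioi (0 : ℝ) = ⋃ n : ℕ, Ioo (0 : ℝ) n := by
    ext x
    simp only [mem_Ioi, mem_iUnion, mem_Ioo, exists_and_left]
    exact ⟨fun hx => ⟨hx, exists_nat_gt x⟩, fun hx => hx.1⟩
  rw [leb, hU, ae_restrict_iUnion_iff]
  intro n
  obtain ⟨C, hC⟩ := hσ.setLIntegral_le (Ioo (0 : ℝ) n) Ioo_subset_Ioi_self
    measurableSet_Ioo.nullMeasurableSet (by simp)
  exact ae_lt_top' (hg.mono_measure (Measure.restrict_mono Ioo_subset_Ioi_self le_rfl))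
    ((hC g hg).trans_lt (ENNReal.mul_lt_top ENNReal.coe_lt_top h)).ne

/-- A bound for `S_a` on non-negative functions yields boundedness of `S_a`. -/
lemma sBounded_of_SNonneg_le {σ : (ℝ → ℝ≥0∞) → ℝ≥0∞} (hY : IsBanachFunctionNorm Y)
    (hσ : IsBanachFunctionNorm σ) (ha : AntitoneOn a (Ioi 0)) {C : ℝ≥0}
    (h : ∀ φ, ClassMPos φ → Y φ < ∞ → σ (SNonneg a φ) ≤ C * Y φ) : SBounded a Y σ := by
  -- The positive and negative parts contribute C each.
  refine ⟨2 * C, fun f ⟨hf, hfY⟩ => ?_⟩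
  have hpos : ClassMPos fun s => (f s).toENNReal := hf.ereal_toENNReal
  have hneg : ClassMPos fun s => (-f s).toENNReal :=
    (continuous_neg.measurable.comp_aemeasurable hf).ereal_toENNReal
  have hY1 : Y (fun s => (f s).toENNReal) ≤ norm Y f := hY.mono _ _ hpos (classMPos_abs hf)
    (Eventually.of_forall fun x => toENNReal_le_abs _)
  have hY2 : Y (fun s => (-f s).toENNReal) ≤ norm Y f := hY.mono _ _ hneg (classMPos_abs hf)
    (Eventually.of_forall fun x => (toENNReal_le_abs _).trans_eq (EReal.abs_neg _))
  have hPm : ClassMPos (SPos a f) := classMPos_SNonneg ha hpos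
  have hNm : ClassMPos (SNeg a f) := classMPos_SNonneg ha hneg
  have hP : σ (SPos a f) ≤ C * norm Y f :=
    (h _ hpos (hY1.trans_lt hfY)).trans (mul_le_mul_right hY1 _)
  have hN : σ (SNeg a f) ≤ C * norm Y f :=
    (h _ hneg (hY2.trans_lt hfY)).trans (mul_le_mul_right hY2 _)
  have hfin : C * norm Y f < ∞ := ENNReal.mul_lt_top ENNReal.coe_lt_top hfY
  have hSm : ClassM (S a f) :=
    AEMeasurable.add hPm.coe_ereal_ennreal
      (continuous_neg.measurable.comp_aemeasurable hNm.coe_ereal_ennreal)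
  have hS : norm σ (S a f) ≤ (2 * C : ℝ≥0) * norm Y f :=
    calc norm σ (S a f) ≤ σ fun t => SPos a f t + SNeg a f t :=
          hσ.mono _ _ (classMPos_abs hSm) (AEMeasurable.add hPm hNm)
            (Eventually.of_forall fun t => abs_coe_sub_coe_le _ _)
      _ ≤ σ (SPos a f) + σ (SNeg a f) := hσ.add_le _ _ hPm hNm
      _ ≤ C * norm Y f + C * norm Y f := add_le_add hP hN
      _ = _ := by push_cast; ring
  refine ⟨?_, ⟨hSm, hS.trans_lt (ENNReal.mul_lt_top ENNReal.coe_lt_top hfY)⟩, hS⟩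
  filter_upwards [hσ.ae_lt_top hPm (hP.trans_lt hfin)] with t ht using Or.inl ht.ne

lemma sBounded_assoc_rhoAlpha (hY : IsBanachFunctionNorm Y)
    (hρ : IsBanachFunctionNorm (rhoAlpha Y)) {M : ℝ≥0} (hM : ∀ x, 0 < x → a x ≤ M)
    (ha1 : ∫⁻ x, a x ∂leb ≠ ∞) (ha : AntitoneOn a (Ioi 0)) :
    SBounded a Y (assoc (rhoAlpha Y)) := by
  obtain ⟨C, hC⟩ := SNonneg_le_alpha hM ha1 ha
  refine sBounded_of_SNonneg_le hY hρ.assoc ha (C := C) fun φ hφ hφY => ?_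
  refine assoc_le fun f hf hf1 => ?_
  calc ∫⁻ x, f x * SNonneg a φ x ∂leb = ∫⁻ x, SNonneg a f x * φ x ∂leb :=
        (lintegral_SNonneg_mul ha hf hφ).symm
    _ ≤ ∫⁻ x, C * (φ x * alpha f x) ∂leb := by
        refine lintegral_mono_ae ?_
        filter_upwards [ae_restrict_mem measurableSet_Ioi] with x hx
        calc SNonneg a f x * φ x ≤ C * alpha f x * φ x := by gcongr; exact hC f hf x hx
          _ = _ := by ring
    _ = C * ∫⁻ x, φ x * alpha f x ∂leb := lintegral_const_mul' _ _ ENNReal.coe_ne_top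
    _ ≤ C * (Y φ * 1) := by
        gcongr
        refine (hY.lintegral_mul_le hφ hφY).trans ?_
        gcongr
        exact hf1
    _ = C * Y φ := by rw [mul_one]

lemma SBounded.exists_SNonneg_le (h : SBounded a Y τ) :
    ∃ K : ℝ≥0, ∀ φ, ClassMPos φ → Y φ < ∞ → τ (SNonneg a φ) ≤ K * Y φ := by
  obtain ⟨K, hK⟩ := h
  refine ⟨K, fun φ hφ hφY => ?_⟩
  have hn : norm Y (fun x => (φ x : EReal)) = Y φ := by simp only [norm, abs_coe_ennreal]
  obtain ⟨-, -, h3⟩ := hK (fun x => (φ x : EReal)) ⟨hφ.coe_ereal_ennreal, by rwa [hn]⟩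
  have hS : ∀ t, S a (fun x => (φ x : EReal)) t = SNonneg a φ t := by
    intro t
    have h1 : SPos a (fun x => (φ x : EReal)) t = SNonneg a φ t := by
      simp only [SPos, SNonneg, EReal.toENNReal_coe]
    have h2 : SNeg a (fun x => (φ x : EReal)) t = 0 := by
      have : ∀ s, (-(φ s : EReal)).toENNReal = 0 := fun s =>
        EReal.toENNReal_of_nonpos (by
          rw [EReal.neg_le, neg_zero]; exact EReal.coe_ennreal_nonneg _)
      simp only [SNeg, this, mul_zero, lintegral_zero]
    rw [S, h1, h2]
    simp
  simpa only [norm, hS, abs_coe_ennreal] using h3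

/-- If `S_a` maps `Y` into an r.i. space, then the associate of the latter embeds
into `X(rhoAlpha Y)`. -/
lemma SBounded.rhoAlpha_le (h : SBounded a Y τ) (hτ : IsRINorm τ) (ha : AntitoneOn a (Ioi 0))
    {M : ℝ≥0} (hM : ∀ x, 0 < x → a x ≤ M) (ha0 : ¬ a =ᵐ[leb] 0) :
    ∃ C : ℝ≥0, ∀ g, ClassMPos g → rhoAlpha Y g ≤ C * assoc τ g := by
  obtain ⟨K, hK⟩ := h.exists_SNonneg_le
  obtain ⟨c, hc0, hc1, hac⟩ := exists_pos_of_not_ae_zero ha ha0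
  set k := a c * ENNReal.ofReal c with hk
  have hk0 : k ≠ 0 := mul_ne_zero hac (ENNReal.ofReal_pos.2 hc0).ne'
  have hkt : k ≠ ∞ :=
    ENNReal.mul_ne_top ((hM c hc0).trans_lt ENNReal.coe_lt_top).ne ENNReal.ofReal_ne_top
  refine ⟨(k⁻¹ * K).toNNReal, fun g hg => ?_⟩
  rw [ENNReal.coe_toNNReal (ENNReal.mul_ne_top (ENNReal.inv_ne_top.2 hk0) ENNReal.coe_ne_top)]
  refine assoc_le fun φ hφ hφ1 => ?_
  have hr : ClassMPos (rearr g) := (rearr_measurable g).aemeasurable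
  have hφt : Y φ < ∞ := hφ1.trans_lt ENNReal.one_lt_top
  have hKφ : τ (SNonneg a φ) ≤ K := (hK φ hφ hφt).trans (by
    calc (K : ℝ≥0∞) * Y φ ≤ K * 1 := by gcongr
      _ = K := mul_one _)
  have h1 : k * ∫⁻ x, φ x * alpha g x ∂leb ≤ K * assoc τ g :=
    calc k * ∫⁻ x, φ x * alpha g x ∂leb = ∫⁻ x, k * (φ x * alpha g x) ∂leb :=
          (lintegral_const_mul' _ _ hkt).symm
      _ ≤ ∫⁻ x, φ x * SNonneg a (rearr g) x ∂leb := by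
          refine lintegral_mono_ae ?_
          filter_upwards [ae_restrict_mem measurableSet_Ioi] with x hx
          rw [mul_left_comm]
          gcongr
          exact mul_alpha_le_SNonneg_rearr ha hc0 hc1 hg hx
      _ = ∫⁻ x, SNonneg a φ x * rearr g x ∂leb := (lintegral_SNonneg_mul ha hφ hr).symm
      _ ≤ τ (SNonneg a φ) * assoc τ (rearr g) :=
          hτ.lintegral_mul_le (classMPos_SNonneg ha hφ) (hKφ.trans_lt ENNReal.coe_lt_top)
      _ ≤ K * assoc τ g := by
          -- Rearrangement invariance of τ' removes the rearrangement introduced by the lower bound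
          -- for `S_a`.
          rw [assoc_eq_assoc_of_distrib_eq hτ hr hg (distrib_rearr g)]
          gcongr
  rw [mul_assoc]
  calc ∫⁻ x, φ x * alpha g x ∂leb = k⁻¹ * (k * ∫⁻ x, φ x * alpha g x ∂leb) := by
        rw [← mul_assoc, ENNReal.inv_mul_cancel hk0 hkt, one_mul]
    _ ≤ _ := by gcongr

end RI

theorem theoremT (a : ℝ → ℝ≥0∞) (ha1 : MemLp a 1 RI.leb) (ha_top : MemLp a ∞ RI.leb)
    (ha_nontriv : ¬ a =ᵐ[RI.leb] 0) (ha_anti : AntitoneOn a (Ioi 0))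
    (Y : (ℝ → ℝ≥0∞) → ℝ≥0∞) (hY : RI.IsRINorm Y) :
    (RI.minOneInv ∈ RI.space (RI.assoc Y) →
      RI.IsRINorm (RI.rhoAlpha Y) ∧
      RI.IsOptimalRangePartner a Y (RI.assoc (RI.rhoAlpha Y))) ∧
    (RI.minOneInv ∉ RI.space (RI.assoc Y) →
      ¬ ∃ Z : (ℝ → ℝ≥0∞) → ℝ≥0∞, RI.IsRINorm Z ∧ RI.SBounded a Y Z) := by
  obtain ⟨M, hM⟩ := RI.exists_forall_le_of_memLp_top ha_top ha_anti
  have hI : ∫⁻ x, a x ∂ RI.leb ≠ ∞ := by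
    have := ha1.2
    rw [eLpNorm_one_eq_lintegral_enorm] at this
    simpa using this.ne
  have hY0 := hY.toIsBanachFunctionNorm
  rw [RI.minOneInv_mem_space_iff]
  refine ⟨fun h => ?_, fun h => ?_⟩
  · have hρ := RI.isRINorm_rhoAlpha hY0 h
    have hρ0 := hρ.toIsBanachFunctionNorm
    refine ⟨hρ, hρ.assoc, RI.sBounded_assoc_rhoAlpha hY0 hρ0 hM hI ha_anti,
      fun τ hτ hSτ => ?_⟩
    obtain ⟨C, hC⟩ := hSτ.rhoAlpha_le hτ ha_anti hM ha_nontriv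
    refine ⟨C, fun f ⟨hf, hfin⟩ => ?_⟩
    -- The chain τ ≤ τ'' ≤ C ρ', the second inequality being the dual of ρ ≤ C τ'.
    have hle : RI.norm τ f ≤ C * RI.norm (RI.assoc (RI.rhoAlpha Y)) f :=
      (hτ.le_assoc_assoc (RI.classMPos_abs hf)).trans (RI.assoc_le_of_le hρ0 hC _)
    exact ⟨⟨hf, hle.trans_lt (ENNReal.mul_lt_top ENNReal.coe_lt_top hfin)⟩, hle⟩
  · rintro ⟨Z, hZ, hSZ⟩
    obtain ⟨C, hC⟩ := hSZ.rhoAlpha_le hZ ha_anti hM ha_nontriv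
    have hm : NullMeasurableSet (Ioo (0 : ℝ) 1) volume := measurableSet_Ioo.nullMeasurableSet
    have hfin : RI.assoc Z ((Ioo (0 : ℝ) 1).indicator 1) < ∞ :=
      hZ.toIsBanachFunctionNorm.assoc.indicator_lt_top _ Ioo_subset_Ioi_self hm (by simp)
    refine h (lt_of_le_of_lt (RI.assoc_mono ?_) ((hC _ (RI.classMPos_indicator_one hm)).trans_lt
      (ENNReal.mul_lt_top ENNReal.coe_lt_top hfin)))
    filter_upwards [ae_restrict_mem measurableSet_Ioi] with t ht using
      RI.le_alpha_indicator_Ioo ht
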